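/- Given integers $k_m\ge 1$ ($m\ge 1$) and integers $1\le n_1<n_2<\cdots$, define words on the alphabet $\{1,2,3\}$ by $H_0=1$, $G_0=2$, $J_0=3$ and, for $m\ge 0$: if $m+1=n_i$ for some $i\ge 1$, then $H_{m+1}=G_mH_m^{k_{m+1}}$, $G_{m+1}=J_mH_m^{k_{m+1}}$, $J_{m+1}=H_m$; otherwise $H_{m+1}=G_mH_m^{k_{m+1}}$, $G_{m+1}=H_m$, $J_{m+1}=J_mH_m^{k_{m+1}}$. Let $L$ be the set of all factors of the words $H_m$. The Arnoux–Rauzy system defined by $(k_m)$ and $(n_i)$ is the one-sided shift $S$ on the set $X_L\subset\{1,2,3\}^{\mathbb N}$ of the infinite sequences all of whose finite factors are in $L$. It has exactly one $S$-invariant Borel probability measure $\mu$; let $e_n$ be the smallest positive value of $\mu[w]$ over the words $w\in L$ of length $n$, where $[w]$ is the set of the sequences in $X_L$ that begin with $w$, and put $$\mathcal B=\limsup_{n\to+\infty}\frac1{n e_n}\in[0,+\infty].$$ The upper BL spectrum of the family of Arnoux–Rauzy systems is the set of all values taken by $\mathcal B$ on these systems. **Proposition.** (1) For the Arnoux–Rauzy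 system defined by $(k_m)$ and $(n_i)$, $\mathcal B=+\infty$ if and only if the sequence $(k_m)_{m\ge1}$ is unbounded or the sequence $(n_{i+1}-n_i)_{i\ge1}$ is unbounded; and $+\infty$ belongs to the upper BL spectrum. (2) The polynomial $X^3-X^2-X-1$ has exactly one real root $y$, with $1.8392<y<1.8393$. For the Tribonacci system ($k_m=1$ for all $m\ge1$ and $n_i=i$ for all $i\ge 1$), $$\mathcal B=2y^2+\frac{4y}{y^2+1},\qquad 8.4445<\mathcal B<8.4446.$$ This value is the smallest element of the upper BL spectrum, and it is the only element of the spectrum that is smaller than $\frac{181}{21}$. -/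

import Mathlib

open MeasureTheory Filter
open scoped ENNReal

noncomputable section

namespace ArnouxRauzy

/-- The three-letter alphabet; the letters `1, 2, 3` are written `0, 1, 2`. -/
abbrev Letter := Fin 3

/-- Finite words. -/
abbrev Word := List Letter

/-- The word `w ^ m`, that is `w` concatenated `m` times with itself. -/
def wordPow (w : Word) (m : ℕ) : Word := (List.replicate m w).flatten

/-! Symbolic systems -/

/-- The one-sided shift on infinite sequences. -/
def shift (x : ℕ → Letter) : ℕ → Letter := fun i => x (i + 1)

/-- The set `X_L` of the infinite sequences all of whose finite factors
`x_r x_{r+1} ⋯ x_{r+m-1}` belong to the language `L`. -/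
def symbolicSpace (L : Set Word) : Set (ℕ → Letter) :=
  {x | ∀ r m : ℕ, List.ofFn (fun i : Fin m => x (r + i)) ∈ L}

/-- The cylinder `[w]` in `X_L`: the sequences of `X_L` that begin with `w`. -/
def cylinder (L : Set Word) (w : Word) : Set (ℕ → Letter) :=
  {x | x ∈ symbolicSpace L ∧ List.ofFn (fun i : Fin w.length => x i) = w}

/-- `μ` is a shift-invariant Borel probability measure on `X_L`, seen as a measure on the space
of all infinite sequences that is carried by `X_L`. -/
structure IsInvariantProbability (L : Set Word) (μ : Measure (ℕ → Letter)) : Prop where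
  isProbabilityMeasure : IsProbabilityMeasure μ
  carried : μ (symbolicSpace L)ᶜ = 0
  invariant : MeasurePreserving shift μ μ

/-- `e_n(μ)`: the smallest positive frequency `μ[w]` of the words `w` of length `n` of `L`
(there are finitely many such words, so the infimum is a minimum). -/
def smallestFrequency (L : Set Word) (μ : Measure (ℕ → Letter)) (n : ℕ) : ℝ≥0∞ :=
  sInf {t | 0 < t ∧ ∃ w ∈ L, w.length = n ∧ μ (cylinder L w) = t}

/-- `limsup_{n → ∞} 1 / (n e_n(μ))`, an element of `[0, +∞]`. -/
def upperBLOf (L : Set Word) (μ : Measure (ℕ → Letter)) : ℝ≥0∞ :=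
  limsup (fun n : ℕ => ((n : ℝ≥0∞) * smallestFrequency L μ n)⁻¹) atTop

/-- The system `(X_L, S)` is uniquely ergodic, and its invariant `𝓑`, computed with its only
invariant probability measure, is equal to `B`. -/
def HasUpperBL (L : Set Word) (B : ℝ≥0∞) : Prop :=
  ∃ μ, IsInvariantProbability L μ ∧ (∀ μ', IsInvariantProbability L μ' → μ' = μ) ∧
    upperBLOf L μ = B

/-! Arnoux–Rauzy systems -/

/-- The sequences that define an Arnoux–Rauzy system: integers `k_m ≥ 1` for `m ≥ 1`, and
integers `1 ≤ n_1 < n_2 < ⋯`. The values `k 0` and `n 0` play no role. -/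
structure IsParameter (k n : ℕ → ℕ) : Prop where
  one_le_k : ∀ m, 1 ≤ m → 1 ≤ k m
  one_le_n : 1 ≤ n 1
  n_lt_succ : ∀ i, 1 ≤ i → n i < n (i + 1)

open Classical in
/-- The triple of words `(H_m, G_m, J_m)`. -/
def words (k n : ℕ → ℕ) : ℕ → Word × Word × Word
  | 0 => ([0], [1], [2])
  | m + 1 =>
    let H := (words k n m).1
    let G := (words k n m).2.1
    let J := (words k n m).2.2
    if ∃ i, 1 ≤ i ∧ n i = m + 1 then
      (G ++ wordPow H (k (m + 1)), J ++ wordPow H (k (m + 1)), H)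
    else
      (G ++ wordPow H (k (m + 1)), H, J ++ wordPow H (k (m + 1)))

/-- The language of the Arnoux–Rauzy system: all factors of the words `H_m`. -/
def language (k n : ℕ → ℕ) : Set Word :=
  {w | ∃ m, w <:+: (words k n m).1}

/-- The upper BL spectrum of the family of Arnoux–Rauzy systems. -/
def upperBLSpectrum : Set ℝ≥0∞ :=
  {B | ∃ k n : ℕ → ℕ, IsParameter k n ∧ HasUpperBL (language k n) B}

end ArnouxRauzy

end

/-! At each level, H, G, J are the return words of a bispecial word p: in p followed by any
concatenation of them, p occurs only at the cutting points (`IsStage.cut`). Appending H to the two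
other words passes from p to pH, so a step of multiplicity k is k additive steps followed by a
permutation. Let h, g, j be the lengths of H, G, J, and a, b, c the measures of the cylinders of pH,
pG, pJ. The additive step gives dual recursions for the two triples, with ha + gb + jc = 1 at every
level (`LengthRec.pairing`), 2|p| + 3 = h + g + j, and 0 < c ≤ b, b + c ≤ a. An invariant measure
exists as a limit of empirical measures. It is unique because the averages of a letter count over H,
G, J come together geometrically (`LengthRec.contraction`), which determines the letter frequencies,
then a, b, c, then the frequencies of all words. The rarest words are governed by c: e_N ≥ c_m for N
≤ |p_m| + 1, while a word of length |p_m| + (k_{m+1} − 1)h_m + 2 has frequency c_{m+1}. The rest is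
arithmetic on these numbers (`Profile`). Infinite values: since ha ≤ 1 and h + g + j ≤ 4h, unbounded
ratios a/c make the limsup infinite; large multiplicities and long runs of unmarked steps produce
them. If multiplicities and runs are bounded, a_m is at most a constant times c_{m+1}. Gap: if all
the products (h_i + g_i + j_i + 2(k_{i+1} − 1)h_i) c_{i+1} near some level exceed 2/9, the
normalization ha + gb + jc = 1 is contradicted as soon as a mark is followed by an unmarked step, or
some k ≥ 2 occurs among marked steps. So a system that is not eventually Tribonacci meets infinitely
many products at most 2/9, which gives the bound 181/21. Eventually Tribonacci systems: the measures
are exactly geometric of ratio 1/y, the lengths are so up to a bounded error, and the limsup is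
computed explicitly. -/

namespace ArnouxRauzy

/-! ### Return words of a bispecial word and the additive step -/

/-- The words of one level of the construction, as a family `W`, together with the bispecial word
`p` of that level: `x i` is the first letter of `W i`, and `l i` is the letter that precedes the
last occurrence of `p` in `p ++ W i`. Occurrences of `p` in concatenations are the cutting
points. -/
structure IsStage (p : Word) (W : Fin 3 → Word) (x l : Fin 3 → Letter) : Prop where
  head_injective : Function.Injective x
  head : ∀ i, ∃ t, W i = x i :: t
  left_injective : Function.Injective l
  left : ∀ i, ∃ r, p ++ W i = r ++ l i :: p
  cut : ∀ (c : List (Fin 3)) (s t : Word), p ++ c.flatMap W = s ++ p ++ t →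
    ∃ c₁ c₂, c = c₁ ++ c₂ ∧ p ++ c₁.flatMap W = s ++ p ∧ c₂.flatMap W = t

/-- The additive step: `W 0` is appended to the two other words. -/
def addStep (W : Fin 3 → Word) : Fin 3 → Word := fun i => if i = 0 then W 0 else W i ++ W 0

/-- The action of the additive step on codes. -/
def addCode (c : List (Fin 3)) : List (Fin 3) := c.flatMap fun i => if i = 0 then [0] else [i, 0]

theorem flatMap_addCode (W : Fin 3 → Word) (c : List (Fin 3)) :
    (addCode c).flatMap W = c.flatMap (addStep W) := by
  induction c with
  | nil => rfl
  | cons i c ih =>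
    have : addCode (i :: c) = (if i = 0 then [0] else [i, 0]) ++ addCode c := by
      simp [addCode]
    rw [this, List.flatMap_append, ih, List.flatMap_cons]
    by_cases h : i = 0 <;> simp [h, addStep]

theorem addCode_cons (i : Fin 3) (c : List (Fin 3)) :
    addCode (i :: c) = (if i = 0 then [0] else [i, 0]) ++ addCode c := by
  simp [addCode]

/-- Every letter 0 of `0 :: addCode c` closes a block, the leading 0 standing for the `W 0` already
absorbed in the new bispecial word. Cutting after a 0 is therefore cutting `c`. -/
theorem addCode_split (c c₁ c₃ : List (Fin 3)) (h : 0 :: addCode c = c₁ ++ 0 :: c₃) :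
    ∃ d₁ d₂, c = d₁ ++ d₂ ∧ 0 :: addCode d₁ = c₁ ++ [0] ∧ addCode d₂ = c₃ := by
  induction c generalizing c₁ with
  | nil =>
    cases c₁ with
    | nil => exact ⟨[], [], rfl, by simp [addCode], by simpa using h⟩
    | cons j c₁ => simp [addCode] at h
  | cons i c ih =>
    cases c₁ with
    | nil => exact ⟨[], i :: c, rfl, by simp [addCode], by simpa using h⟩
    | cons j c₁ =>
      rw [addCode_cons, List.cons_append, List.cons.injEq] at h
      obtain ⟨rfl, h⟩ := h
      by_cases hi : i = 0
      · subst hi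
        obtain ⟨d₁, d₂, rfl, h₁, h₂⟩ := ih c₁ (by simpa using h)
        refine ⟨0 :: d₁, d₂, rfl, ?_, h₂⟩
        simp [addCode_cons, h₁]
      · cases c₁ with
        | nil => simp [hi] at h
        | cons j c₁ =>
          simp only [hi, if_false, List.cons_append, List.nil_append, List.cons.injEq] at h
          obtain ⟨rfl, h⟩ := h
          obtain ⟨d₁, d₂, rfl, h₁, h₂⟩ := ih c₁ h
          refine ⟨i :: d₁, d₂, rfl, ?_, h₂⟩
          simp [addCode_cons, hi, h₁]

/-- Each block ends with 0, and a letter i ≠ 0 opens its block, so it comes right after a 0. -/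
theorem addCode_preceded (c c₁ c₂ : List (Fin 3)) (i : Fin 3) (hi : i ≠ 0)
    (h : 0 :: addCode c = c₁ ++ i :: c₂) : ∃ c₀, c₁ = c₀ ++ [0] := by
  induction c generalizing c₁ with
  | nil =>
    cases c₁ with
    | nil => simp [addCode] at h; exact absurd h.1.symm hi
    | cons j c₁ => simp [addCode] at h
  | cons k c ih =>
    cases c₁ with
    | nil => simp at h; exact absurd h.1.symm hi
    | cons j c₁ =>
      rw [addCode_cons, List.cons_append, List.cons.injEq] at h
      obtain ⟨rfl, h⟩ := h
      by_cases hk : k = 0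
      · subst hk
        obtain ⟨c₀, rfl⟩ := ih c₁ (by simpa using h)
        exact ⟨0 :: c₀, rfl⟩
      · cases c₁ with
        | nil => exact ⟨[], rfl⟩
        | cons j c₁ =>
          simp only [hk, if_false, List.cons_append, List.nil_append, List.cons.injEq] at h
          obtain ⟨rfl, h⟩ := h
          obtain ⟨c₀, rfl⟩ := ih c₁ h
          exact ⟨0 :: k :: c₀, rfl⟩

namespace IsStage

variable {p : Word} {W : Fin 3 → Word} {x l : Fin 3 → Letter}

theorem suffix (hs : IsStage p W x l) (c : List (Fin 3)) : ∃ s, p ++ c.flatMap W = s ++ p := by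
  induction c using List.reverseRecOn with
  | nil => exact ⟨[], by simp⟩
  | append_singleton c i ih =>
    obtain ⟨s, h⟩ := ih
    obtain ⟨r, hr⟩ := hs.left i
    refine ⟨s ++ r ++ [l i], ?_⟩
    rw [List.flatMap_append, ← List.append_assoc, h]
    simp [hr]

theorem ne_nil (hs : IsStage p W x l) (i : Fin 3) : W i ≠ [] := by
  obtain ⟨t, h⟩ := hs.head i
  simp [h]

theorem length_pos (hs : IsStage p W x l) (i : Fin 3) : 0 < (W i).length :=
  List.length_pos_of_ne_nil (hs.ne_nil i)

theorem code_of_head (hs : IsStage p W x l) {c : List (Fin 3)} {i : Fin 3} {t : Word}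
    (h : c.flatMap W = x i :: t) : ∃ c', c = i :: c' := by
  cases c with
  | nil => simp at h
  | cons j c =>
    obtain ⟨t', h'⟩ := hs.head j
    rw [List.flatMap_cons, h', List.cons_append, List.cons.injEq] at h
    exact ⟨c, by rw [hs.head_injective h.1]⟩

/-- An occurrence of p W₀ is an occurrence of p followed by W₀, hence a cut of the old code just
before a 0; `addCode_split` turns it into a cut of the new code. First letters and left letters do
not change. -/
theorem addStep (hs : IsStage p W x l) : IsStage (p ++ W 0) (addStep W) x l where
  head_injective := hs.head_injective
  head i := by
    obtain ⟨t, h⟩ := hs.head i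
    by_cases hi : i = 0
    · exact ⟨t, by subst hi; simp [ArnouxRauzy.addStep, h]⟩
    · exact ⟨t ++ W 0, by simp [ArnouxRauzy.addStep, h, hi]⟩
  left_injective := hs.left_injective
  left i := by
    obtain ⟨r, hr⟩ := hs.left i
    by_cases hi : i = 0
    · subst hi
      exact ⟨r, by simp [ArnouxRauzy.addStep, hr]⟩
    · obtain ⟨r₀, h₀⟩ := hs.left 0
      refine ⟨r₀ ++ [l 0] ++ r, ?_⟩
      simp only [ArnouxRauzy.addStep, hi, if_false]
      rw [h₀]
      have : p ++ (W i ++ W 0) = r ++ l i :: p ++ W 0 := by rw [← List.append_assoc, hr]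
      simp only [List.append_assoc, List.cons_append, List.nil_append] at this ⊢
      rw [this]
      rw [← h₀]
  cut c s t h := by
    have e : ∀ c : List (Fin 3), p ++ W 0 ++ c.flatMap (ArnouxRauzy.addStep W)
        = p ++ (0 :: addCode c).flatMap W := by
      intro c
      rw [List.flatMap_cons, flatMap_addCode, List.append_assoc]
    rw [e, ← List.append_assoc, List.append_assoc (s ++ p)] at h
    obtain ⟨c₁, c₂, h₁, h₂, h₃⟩ := hs.cut _ _ _ h
    obtain ⟨t₀, ht₀⟩ := hs.head 0
    obtain ⟨c₃, rfl⟩ := hs.code_of_head (i := 0) (t := t₀ ++ t) (by rw [h₃, ht₀]; rfl)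
    obtain ⟨d₁, d₂, rfl, h₄, h₅⟩ := addCode_split _ _ _ h₁
    refine ⟨d₁, d₂, rfl, ?_, ?_⟩
    · rw [e, h₄, List.flatMap_append, ← List.append_assoc, h₂]
      simp
    · rw [← flatMap_addCode, h₅]
      simpa using h₃

theorem perm (hs : IsStage p W x l) (σ : Equiv.Perm (Fin 3)) :
    IsStage p (W ∘ σ) (x ∘ σ) (l ∘ σ) where
  head_injective := hs.head_injective.comp σ.injective
  head i := hs.head (σ i)
  left_injective := hs.left_injective.comp σ.injective
  left i := hs.left (σ i)
  cut c s t h := by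
    have e : ∀ c : List (Fin 3), c.flatMap (W ∘ σ) = (c.map σ).flatMap W := by
      intro c
      rw [List.flatMap_map]; rfl
    rw [e] at h
    obtain ⟨c₁, c₂, h₁, h₂, h₃⟩ := hs.cut _ _ _ h
    obtain ⟨d₁, d₂, rfl, rfl, rfl⟩ := List.map_eq_append_iff.1 h₁
    exact ⟨d₁, d₂, rfl, by rw [e, h₂], by rw [e, h₃]⟩

theorem window (hs : IsStage p W x l) (c : List (Fin 3)) (N : ℕ) (hN : N < (c.flatMap W).length) :
    ∃ (i : Fin 3) (s t : Word), p ++ c.flatMap W = s ++ (p ++ W i) ++ t ∧ s.length ≤ N ∧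
      N < s.length + (W i).length := by
  induction c using List.reverseRecOn with
  | nil => simp at hN
  | append_singleton c i ih =>
    rw [List.flatMap_append] at hN ⊢
    by_cases h : N < (c.flatMap W).length
    · obtain ⟨j, s, t, h₁, h₂, h₃⟩ := ih h
      refine ⟨j, s, t ++ [i].flatMap W, ?_, h₂, h₃⟩
      rw [← List.append_assoc, h₁, List.append_assoc, List.append_assoc, List.append_assoc]
    · obtain ⟨s, h₁⟩ := hs.suffix c
      have hl := congrArg List.length h₁
      simp only [List.length_append] at hl hN
      refine ⟨i, s, [], ?_, by omega, ?_⟩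
      · rw [← List.append_assoc, h₁]; simp
      · simp only [List.flatMap_cons, List.flatMap_nil, List.append_nil] at hN; omega

theorem zero : IsStage [] (fun i => [i]) id id where
  head_injective := Function.injective_id
  head i := ⟨[], rfl⟩
  left_injective := Function.injective_id
  left i := ⟨[], rfl⟩
  cut c s t h := by
    simp only [List.nil_append, List.append_nil] at h ⊢
    have e : ∀ c : List (Fin 3), c.flatMap (fun i => [i]) = c := fun c => by simp
    exact ⟨s, t, by rw [← e c, h], e s, e t⟩

end IsStage

end ArnouxRauzy

/-! ### Reading the stages inside the sequences of the system -/

namespace ArnouxRauzy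

/-- The factor of length `m` of the sequence `y` at position `r`. -/
def win (y : ℕ → Letter) (r m : ℕ) : Word := List.ofFn fun i : Fin m => y (r + i)

@[simp] theorem length_win (y : ℕ → Letter) (r m : ℕ) : (win y r m).length = m := by simp [win]

theorem win_add (y : ℕ → Letter) (r m n : ℕ) :
    win y r (m + n) = win y r m ++ win y (r + m) n := by
  simp [win, List.ofFn_add, add_assoc]

theorem win_mem {L : Set Word} {y : ℕ → Letter} (hy : y ∈ symbolicSpace L) (r m : ℕ) :
    win y r m ∈ L := hy r m

theorem win_eq_of_append {y : ℕ → Letter} {r n : ℕ} {s w t : Word} (h : win y r n = s ++ w ++ t) :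
    win y (r + s.length) w.length = w := by
  have hn : n = s.length + (w.length + t.length) := by
    have := congrArg List.length h
    simp at this; omega
  rw [hn, win_add, win_add, List.append_assoc] at h
  have h₁ := (List.append_inj h (by simp)).2
  exact (List.append_inj h₁ (by simp)).1

/-- Every word of `L` is a factor of a concatenation of words of `W`. -/
def Codes (L : Set Word) (W : Fin 3 → Word) : Prop :=
  ∀ u ∈ L, ∃ c : List (Fin 3), u <:+: c.flatMap W

theorem Codes.of_words {L : Set Word} {W V : Fin 3 → Word} (h : Codes L W)
    (hV : ∀ i, ∃ c : List (Fin 3), W i = c.flatMap V) : Codes L V := by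
  choose d hd using hV
  intro u hu
  obtain ⟨c, hc⟩ := h u hu
  refine ⟨c.flatMap d, ?_⟩
  rw [List.flatMap_assoc]
  simpa only [← hd] using hc

theorem Codes.of_addStep {L : Set Word} {W : Fin 3 → Word} (h : Codes L (addStep W)) :
    Codes L W := by
  refine h.of_words fun i => ⟨addCode [i], ?_⟩
  rw [flatMap_addCode]
  simp

namespace IsStage

variable {p : Word} {W : Fin 3 → Word} {x l : Fin 3 → Letter} {L : Set Word} {y : ℕ → Letter}

theorem exists_code (hc : Codes L W) {u : Word} (hu : u ∈ L) :
    ∃ (c : List (Fin 3)) (s t : Word), p ++ c.flatMap W = s ++ u ++ t := by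
  obtain ⟨c, s, t, h⟩ := hc u hu
  exact ⟨c, p ++ s, t, by rw [← h]; simp⟩

/-- Every occurrence of p is a cut, and the three first letters are distinct, so the letter after p
identifies the whole next return word. -/
theorem win_word (hs : IsStage p W x l) (hc : Codes L W) (hy : y ∈ symbolicSpace L) {K : ℕ}
    {i : Fin 3} (h : win y K (p.length + 1) = p ++ [x i]) :
    win y K (p.length + (W i).length) = p ++ W i := by
  obtain ⟨c, s, t, e⟩ := exists_code (p := p) hc (win_mem hy K (p.length + (W i).length))
  obtain ⟨n, hn⟩ : ∃ n, (W i).length = n + 1 := ⟨_, (Nat.succ_pred (hs.length_pos i).ne').symm⟩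
  have e' : win y K (p.length + (W i).length) =
      p ++ x i :: win y (K + (p.length + 1)) n := by
    rw [hn, add_comm n 1, ← add_assoc, win_add, h]; simp
  rw [e'] at e ⊢
  have e₂ : p ++ c.flatMap W = s ++ p ++ (x i :: (win y (K + (p.length + 1)) n ++ t)) := by
    rw [e]; simp
  obtain ⟨c₁, c₂, -, -, h₃⟩ := hs.cut _ _ _ e₂
  obtain ⟨c', rfl⟩ := hs.code_of_head h₃
  rw [List.flatMap_cons, ← List.cons_append] at h₃
  rw [(List.append_inj h₃ (by simp [hn])).1]

/-- In a code of the next stage, a word W i with i ≠ 0 always comes after W 0, so the occurrence of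
p before it extends to the left to p W₀. -/
theorem win_left (hs : IsStage p W x l) (hc : Codes L (ArnouxRauzy.addStep W))
    (hy : y ∈ symbolicSpace L) {K : ℕ} {i : Fin 3} (hi : i ≠ 0)
    (h : win y (K + (W 0).length) (p.length + 1) = p ++ [x i]) :
    win y K ((W 0).length + (p.length + 1)) = p ++ W 0 ++ [x i] := by
  obtain ⟨c, s, t, e⟩ := exists_code (p := p ++ W 0) hc
    (win_mem hy K ((W 0).length + (p.length + 1)))
  rw [win_add, h] at e ⊢
  set v := win y K (W 0).length with hv
  have e₂ : p ++ (0 :: addCode c).flatMap W = (s ++ v) ++ p ++ (x i :: t) := by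
    rw [List.flatMap_cons, flatMap_addCode, ← List.append_assoc, e]; simp
  obtain ⟨c₁, c₂, h₁, h₂, h₃⟩ := hs.cut _ _ _ e₂
  obtain ⟨c', rfl⟩ := hs.code_of_head h₃
  obtain ⟨c₀, rfl⟩ := addCode_preceded _ _ _ _ hi h₁
  obtain ⟨s', hs'⟩ := hs.suffix c₀
  rw [List.flatMap_append, ← List.append_assoc, hs'] at h₂
  have h₄ : s' ++ (p ++ W 0) = s ++ (v ++ p) := by simpa using h₂
  have := (List.append_inj' h₄ (by simp [hv, add_comm])).2
  rw [← List.append_assoc, this]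

/-- The left letters are distinct, so the letter before an occurrence of p identifies the return
word just completed. -/
theorem win_left_letter (hs : IsStage p W x l) (hc : Codes L W)
    (hy : y ∈ symbolicSpace L) {K : ℕ} {a : Letter}
    (h : win y (K + ((W 0).length - 1)) (p.length + 2) = l 0 :: p ++ [a]) :
    win y K ((W 0).length + (p.length + 1)) = p ++ W 0 ++ [a] := by
  obtain ⟨n, hn⟩ : ∃ n, (W 0).length = n + 1 := ⟨_, (Nat.succ_pred (hs.length_pos 0).ne').symm⟩
  have hlen : (W 0).length + (p.length + 1) = n + (p.length + 2) := by omega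
  have hn' : (W 0).length - 1 = n := by omega
  rw [hn'] at h
  obtain ⟨c, s, t, e⟩ := exists_code (p := p) hc
    (win_mem hy K (n + (p.length + 2)))
  rw [hlen]
  rw [win_add, h] at e ⊢
  set v := win y K n with hv
  have e₂ : p ++ c.flatMap W = (s ++ v ++ [l 0]) ++ p ++ (a :: t) := by
    rw [e]; simp
  obtain ⟨c₁, c₂, -, h₂, h₃⟩ := hs.cut _ _ _ e₂
  induction c₁ using List.reverseRecOn with
  | nil =>
    have := congrArg List.length h₂
    simp at this
    omega
  | append_singleton c₁ j _ =>
    obtain ⟨s', hs'⟩ := hs.suffix c₁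
    obtain ⟨r, hr⟩ := hs.left j
    rw [List.flatMap_append, ← List.append_assoc, hs'] at h₂
    have h₄ : (s' ++ r) ++ (l j :: p) = (s ++ v) ++ (l 0 :: p) := by
      have : s' ++ p ++ W j = s' ++ (r ++ l j :: p) := by rw [← hr]; simp
      simp only [List.flatMap_cons, List.flatMap_nil, List.append_nil] at h₂
      rw [this] at h₂
      simpa using h₂
    have h₅ := (List.append_inj' h₄ (by simp)).2
    rw [List.cons.injEq] at h₅
    have hj := hs.left_injective h₅.1
    subst hj
    have h₆ : s' ++ (p ++ W 0) = s ++ (v ++ l 0 :: p) := by simpa using h₂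
    have := (List.append_inj' h₆ (by simp [hv]; omega)).2
    rw [this]; simp

/-- The time K is at least every height, so that the base of the tower, r steps earlier, does not
fall before the origin; the window of length 2K + |p| also contains the end of the tower. -/
theorem win_tower (hs : IsStage p W x l) (hc : Codes L W) (hy : y ∈ symbolicSpace L) {K : ℕ}
    (hK : ∀ i, (W i).length ≤ K) :
    ∃ i, ∃ r < (W i).length, win y (K - r) (p.length + (W i).length) = p ++ W i := by
  obtain ⟨c, s, t, e⟩ := exists_code (p := p) hc (win_mem hy 0 (K + (p.length + K)))
  have hl := congrArg List.length e
  simp only [List.length_append, length_win] at hl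
  obtain ⟨j, hj⟩ : ∃ j : Fin 3, j = 0 := ⟨0, rfl⟩
  have := hs.length_pos j
  have := hK j
  obtain ⟨i, s', t', e', h₁, h₂⟩ := hs.window c (s.length + K) (by omega)
  have hKi := hK i
  refine ⟨i, s.length + K - s'.length, by omega, ?_⟩
  have hl' := congrArg List.length e'
  simp only [List.length_append] at hl'
  have hss : s.length ≤ s'.length := by omega
  rw [e'] at e
  have e₁ : (s' ++ (p ++ W i)) ++ t' = s ++ (win y 0 (K + (p.length + K)) ++ t) := by
    simpa using e
  rw [List.append_assoc] at e₁
  obtain ⟨u, rfl, e₂⟩ | ⟨u, rfl, e₂⟩ := List.append_eq_append_iff.1 e₁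
  · have : u = [] := by
      simp at hss; exact hss
    subst this
    rw [List.nil_append] at e₂
    rw [List.append_nil]
    have e₃ : win y 0 (p.length + (W i).length) = p ++ W i := by
      have e4 : K + (p.length + K) = (p.length + (W i).length) + (K + K - (W i).length) := by omega
      rw [e4, win_add, List.append_assoc (win _ _ _)] at e₂
      exact ((List.append_inj e₂ (by simp)).1).symm
    simpa using e₃
  · simp only [List.length_append] at h₁ h₂ hl'
    have hle : K + (p.length + K) = u.length + ((p.length + (W i).length) +
      (K + K - u.length - (W i).length)) := by omega
    rw [hle, win_add, win_add, List.append_assoc, List.append_assoc] at e₂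
    have e₃ := (List.append_inj e₂ (by simp)).2
    have e₄ := (List.append_inj e₃ (by simp)).1.symm
    rw [zero_add] at e₄
    have : K - (s.length + K - (s ++ u).length) = u.length := by simp; omega
    rw [this, ← e₄]

/-- Take the block W i that contains the last letter of w: the word p supplies |p| further letters
to its left, which is enough. -/
theorem infix_of_mem (hs : IsStage p W x l) (hc : Codes L W) {w : Word} (hw : w ∈ L)
    (hlen : w.length ≤ p.length + 1) : ∃ i, w <:+: p ++ W i := by
  by_cases hw0 : w = []
  · exact ⟨0, by subst hw0; exact List.nil_infix⟩
  have hpos := List.length_pos_of_ne_nil hw0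
  obtain ⟨c, s, t, h⟩ := hc w hw
  have hl := congrArg List.length h
  simp only [List.length_append] at hl
  obtain ⟨i, s', t', e, h₁, h₂⟩ := hs.window c (s.length + w.length - 1) (by omega)
  refine ⟨i, ?_⟩
  have e₁ : s' ++ ((p ++ W i) ++ t') = (p ++ s) ++ (w ++ t) := by
    rw [← List.append_assoc, ← e, ← h]; simp
  have hl' := congrArg List.length e₁
  simp only [List.length_append] at hl'
  obtain ⟨u, hu, e₂⟩ | ⟨u, hu, e₂⟩ := List.append_eq_append_iff.1 e₁
  · rw [← List.append_assoc] at e₂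
    have hul := congrArg List.length hu
    simp only [List.length_append] at hul
    obtain ⟨q, hq, -⟩ | ⟨q, hq, e₃⟩ := List.append_eq_append_iff.1 e₂
    · have := congrArg List.length hq
      simp only [List.length_append] at this
      have hq0 : q = [] := List.length_eq_zero_iff.1 (by omega)
      subst hq0
      exact ⟨u, [], by simpa using hq⟩
    · exact ⟨u, q, hq.symm⟩
  · have hul := congrArg List.length hu
    simp only [List.length_append] at hul
    have hu0 : u = [] := List.length_eq_zero_iff.1 (by omega)
    subst hu0
    rw [List.nil_append] at e₂
    obtain ⟨q, hq, -⟩ | ⟨q, hq, e₃⟩ := List.append_eq_append_iff.1 e₂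
    · exact ⟨[], q, by simpa using hq.symm⟩
    · have := congrArg List.length hq
      simp only [List.length_append] at this
      have hq0 : q = [] := List.length_eq_zero_iff.1 (by omega)
      subst hq0
      exact ⟨[], [], by simpa using hq⟩

end IsStage

end ArnouxRauzy

/-! ### Frequencies of words and of return words -/

namespace ArnouxRauzy

theorem isClopen_win (K n : ℕ) (S : Set Word) : IsClopen {y : ℕ → Letter | win y K n ∈ S} := by
  have h : Continuous fun (y : ℕ → Letter) (i : Fin n) => y (K + i) := by fun_prop
  have : {y : ℕ → Letter | win y K n ∈ S} =
      (fun (y : ℕ → Letter) (i : Fin n) => y (K + i)) ⁻¹' {f | List.ofFn f ∈ S} := rfl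
  rw [this]
  exact (isClopen_discrete _).preimage h

theorem measurableSet_win (K n : ℕ) (S : Set Word) :
    MeasurableSet {y : ℕ → Letter | win y K n ∈ S} :=
  (isClopen_win K n S).isOpen.measurableSet

theorem measurableSet_win_eq (K n : ℕ) (w : Word) :
    MeasurableSet {y : ℕ → Letter | win y K n = w} := measurableSet_win K n {w}

/-- The frequency of a word: the measure of the set of sequences that begin with it. -/
noncomputable def fr (μ : Measure (ℕ → Letter)) (w : Word) : ℝ :=
  μ.real {y | win y 0 w.length = w}

theorem shift_iterate (K : ℕ) (y : ℕ → Letter) (i : ℕ) : (shift^[K] y) i = y (K + i) := by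
  induction K generalizing y with
  | zero => simp
  | succ K ih => rw [Function.iterate_succ_apply, ih, shift]; congr 1; omega

theorem win_shift (K r n : ℕ) (y : ℕ → Letter) : win (shift^[K] y) r n = win y (K + r) n := by
  simp [win, shift_iterate, add_assoc]

theorem fr_nonneg (μ : Measure (ℕ → Letter)) (w : Word) : 0 ≤ fr μ w := measureReal_nonneg

namespace IsInvariantProbability

variable {L : Set Word} {μ : Measure (ℕ → Letter)}

theorem measureReal_win (hμ : IsInvariantProbability L μ) (K : ℕ) (w : Word) :
    μ.real {y | win y K w.length = w} = fr μ w := by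
  have h := (hμ.invariant.iterate K).measureReal_preimage
    (measurableSet_win_eq 0 w.length w).nullMeasurableSet
  rw [fr, ← h]
  simp [Set.preimage, win_shift]

theorem measureReal_mono (hμ : IsInvariantProbability L μ) {A B : Set (ℕ → Letter)}
    (h : ∀ y ∈ symbolicSpace L, y ∈ A → y ∈ B) : μ.real A ≤ μ.real B := by
  have := hμ.isProbabilityMeasure
  refine ENNReal.toReal_mono (measure_ne_top _ _) (measure_mono_ae ?_)
  have : ∀ᵐ y ∂μ, y ∈ symbolicSpace L := hμ.carried
  filter_upwards [this] with y hy using h y hy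

theorem fr_le (hμ : IsInvariantProbability L μ) {u w : Word} (K K' : ℕ)
    (h : ∀ y ∈ symbolicSpace L, win y K u.length = u → win y K' w.length = w) :
    fr μ u ≤ fr μ w := by
  rw [← hμ.measureReal_win K, ← hμ.measureReal_win K']
  exact hμ.measureReal_mono h

theorem fr_infix (hμ : IsInvariantProbability L μ) {u w : Word} (h : u <:+: w) :
    fr μ w ≤ fr μ u := by
  obtain ⟨s, t, rfl⟩ := h
  exact hμ.fr_le 0 (0 + s.length) fun y _ hy => win_eq_of_append hy

theorem fr_sum (hμ : IsInvariantProbability L μ) (w : Word) :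
    fr μ w = ∑ a, fr μ (w ++ [a]) := by
  have := hμ.isProbabilityMeasure
  have h : {y : ℕ → Letter | win y 0 w.length = w} =
      ⋃ a ∈ (Finset.univ : Finset Letter), {y | win y 0 (w ++ [a]).length = w ++ [a]} := by
    ext y
    simp only [Set.mem_ofPred_eq, Set.mem_iUnion, List.length_append, List.length_singleton,
      Finset.mem_univ, exists_true_left]
    constructor
    · intro hy
      refine ⟨y w.length, ?_⟩
      rw [win_add, hy]
      simp [win]
    · rintro ⟨a, ha⟩
      rw [win_add] at ha
      exact (List.append_inj ha (by simp)).1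
  rw [fr, h, measureReal_biUnion_finset]
  · rfl
  · intro a _ b _ hab
    refine Set.disjoint_left.2 fun y hy hy' => hab ?_
    simp only [Set.mem_ofPred_eq, List.length_append, List.length_singleton] at hy hy'
    rw [hy] at hy'
    simpa using hy'
  · intro a _
    exact measurableSet_win_eq _ _ _

theorem fr_nil (hμ : IsInvariantProbability L μ) : fr μ [] = 1 := by
  have := hμ.isProbabilityMeasure
  simp [fr, win]

end IsInvariantProbability

namespace IsStage

variable {p : Word} {W : Fin 3 → Word} {x l : Fin 3 → Letter} {L : Set Word}
  {μ : Measure (ℕ → Letter)}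

theorem fr_head (hs : IsStage p W x l) (hc : Codes L W) (hμ : IsInvariantProbability L μ)
    (i : Fin 3) : fr μ (p ++ [x i]) = fr μ (p ++ W i) := by
  apply le_antisymm
  · refine hμ.fr_le 0 0 fun y hy h => ?_
    rw [List.length_append] at h ⊢
    exact hs.win_word hc hy h
  · obtain ⟨t, ht⟩ := hs.head i
    exact hμ.fr_infix ⟨[], t, by simp [ht]⟩

theorem fr_eq_sum (hs : IsStage p W x l) (hc : Codes L W) (hμ : IsInvariantProbability L μ) :
    fr μ p = ∑ i, fr μ (p ++ W i) := by
  rw [hμ.fr_sum p, ← (Finite.injective_iff_bijective.1 hs.head_injective).sum_comp]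
  exact Finset.sum_congr rfl fun i _ => hs.fr_head hc hμ i

/-- For i ≠ 0 the word W i is always preceded by W₀ and followed by W₀, so the extension changes no
frequency. -/
theorem fr_addStep (hs : IsStage p W x l) (hc : Codes L (ArnouxRauzy.addStep W))
    (hμ : IsInvariantProbability L μ) {i : Fin 3} (hi : i ≠ 0) :
    fr μ (p ++ W 0 ++ ArnouxRauzy.addStep W i) = fr μ (p ++ W i) := by
  rw [← hs.addStep.fr_head hc hμ, ← hs.fr_head hc.of_addStep hμ]
  apply le_antisymm
  · obtain ⟨r, hr⟩ := hs.left 0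
    exact hμ.fr_infix ⟨r ++ [l 0], [], by rw [hr]; simp⟩
  · refine hμ.fr_le (0 + (W 0).length) 0 fun y hy h => ?_
    have := hs.win_left hc hy hi (K := 0) (by simpa using h)
    convert this using 2
    simp; omega

/-- An occurrence of p W₀ branches according to the next return word, and the branches 1 and 2 carry
the old measures by `fr_addStep`. -/
theorem fr_addStep_zero (hs : IsStage p W x l) (hc : Codes L (ArnouxRauzy.addStep W))
    (hμ : IsInvariantProbability L μ) :
    fr μ (p ++ W 0) = fr μ (p ++ W 0 ++ ArnouxRauzy.addStep W 0) + fr μ (p ++ W 1) +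
      fr μ (p ++ W 2) := by
  rw [hs.addStep.fr_eq_sum hc hμ, Fin.sum_univ_three, hs.fr_addStep hc hμ one_ne_zero,
    hs.fr_addStep hc hμ (by decide : (2 : Fin 3) ≠ 0)]

/-- Source of the rare words: only two letters longer than p, this word already has a frequency of
the next stage. -/
theorem fr_left_letter (hs : IsStage p W x l) (hc : Codes L (ArnouxRauzy.addStep W))
    (hμ : IsInvariantProbability L μ) (i : Fin 3) :
    fr μ (l 0 :: p ++ [x i]) = fr μ (p ++ W 0 ++ ArnouxRauzy.addStep W i) := by
  rw [← hs.addStep.fr_head hc hμ]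
  apply le_antisymm
  · refine hμ.fr_le (0 + ((W 0).length - 1)) 0 fun y hy h => ?_
    have := hs.win_left_letter hc.of_addStep hy (K := 0) (a := x i) (by simpa using h)
    convert this using 2
    simp; omega
  · obtain ⟨r, hr⟩ := hs.left 0
    exact hμ.fr_infix ⟨r, [], by rw [hr]; simp⟩

/-- The number of occurrences of `w` that begin in the tower of `W i`. -/
def occ (p : Word) (W : Fin 3 → Word) (w : Word) (i : Fin 3) : ℕ :=
  ((Finset.range (W i).length).filter fun r => ((p ++ W i).drop r).take (p.length + 1) = w).card

/-- Each of the |W i| positions of the tower reads exactly one word of length |p| + 1. -/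
theorem sum_occ (p : Word) (W : Fin 3 → Word) (i : Fin 3) :
    ∑ f : Fin (p.length + 1) → Letter, occ p W (List.ofFn f) i = (W i).length := by
  classical
  have h := Finset.card_eq_sum_card_fiberwise (s := Finset.range (W i).length)
    (f := fun r => fun k : Fin (p.length + 1) => (p ++ W i).getD (r + k) 0)
    (t := Finset.univ) (fun _ _ => Finset.mem_coe.2 (Finset.mem_univ _))
  rw [Finset.card_range] at h
  rw [h]
  refine Finset.sum_congr rfl fun f _ => ?_
  rw [occ]
  congr 1
  refine Finset.filter_congr fun r hr => ?_
  rw [Finset.mem_range] at hr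
  have : ((p ++ W i).drop r).take (p.length + 1) =
      List.ofFn fun k : Fin (p.length + 1) => (p ++ W i).getD (r + k) 0 := by
    apply List.ext_getElem
    · simp; omega
    · intro k h₁ h₂
      simp only [List.length_ofFn] at h₂
      simp only [List.getElem_take, List.getElem_drop, List.getElem_ofFn]
      rw [List.getD_eq_getElem]
  rw [this, List.ofFn_inj]

/-- The towers cover the system, so the union bound suffices; no disjointness is needed, since
`fr_eq_sum_occ` recovers equality by comparing totals. -/
theorem fr_le_sum_occ (hs : IsStage p W x l) (hc : Codes L W) (hμ : IsInvariantProbability L μ)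
    {w : Word} (hw : w.length = p.length + 1) :
    fr μ w ≤ ∑ i, occ p W w i * fr μ (p ++ W i) := by
  classical
  have := hμ.isProbabilityMeasure
  obtain ⟨K, hK⟩ : ∃ K, ∀ i, (W i).length ≤ K :=
    ⟨∑ i, (W i).length, fun i => Finset.single_le_sum (f := fun i => (W i).length)
      (fun _ _ => Nat.zero_le _) (Finset.mem_univ i)⟩
  let F : Fin 3 → Finset ℕ := fun i =>
    (Finset.range (W i).length).filter fun r => ((p ++ W i).drop r).take (p.length + 1) = w
  let A : Fin 3 → ℕ → Set (ℕ → Letter) := fun i r =>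
    {y | win y (K - r) (p ++ W i).length = p ++ W i}
  calc fr μ w = μ.real {y | win y K w.length = w} := (hμ.measureReal_win K w).symm
    _ ≤ μ.real (⋃ i ∈ (Finset.univ : Finset (Fin 3)), ⋃ r ∈ F i, A i r) := by
      refine hμ.measureReal_mono fun y hy h => ?_
      obtain ⟨i, r, hr, h'⟩ := hs.win_tower hc hy hK
      have hKi := hK i
      simp only [Set.mem_iUnion, Finset.mem_univ, exists_true_left]
      refine ⟨i, r, ?_, by simpa [A] using h'⟩
      rw [Finset.mem_filter, Finset.mem_range]
      refine ⟨hr, ?_⟩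
      rw [← h']
      rw [Set.mem_ofPred_eq, hw] at h
      have e : p.length + (W i).length = r + ((p.length + 1) + ((W i).length - 1 - r)) := by omega
      have e' : K - r + r = K := by omega
      rw [e, win_add, win_add, e', h, List.drop_left' (by simp), List.take_left' hw]
    _ ≤ ∑ i, μ.real (⋃ r ∈ F i, A i r) := measureReal_biUnion_finset_le _ _
    _ ≤ ∑ i, ∑ r ∈ F i, μ.real (A i r) :=
      Finset.sum_le_sum fun i _ => measureReal_biUnion_finset_le _ _
    _ = ∑ i, occ p W w i * fr μ (p ++ W i) := by
      refine Finset.sum_congr rfl fun i _ => ?_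
      rw [Finset.sum_congr rfl fun r _ => hμ.measureReal_win (K - r) (p ++ W i), Finset.sum_const,
        nsmul_eq_mul]
      rfl

end IsStage

theorem IsInvariantProbability.sum_fr {L : Set Word} {μ : Measure (ℕ → Letter)}
    (hμ : IsInvariantProbability L μ) (n : ℕ) :
    ∑ f : Fin n → Letter, fr μ (List.ofFn f) = 1 := by
  have := hμ.isProbabilityMeasure
  have h := sum_measureReal_preimage_singleton (μ := μ) (f := fun (y : ℕ → Letter) (i : Fin n) => y i)
    Finset.univ (fun f _ => (measurable_pi_lambda _ fun i => measurable_pi_apply _)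
      (measurableSet_singleton f))
  simp only [Finset.coe_univ, Set.preimage_univ, probReal_univ] at h
  rw [← h]
  refine Finset.sum_congr rfl fun f _ => ?_
  rw [fr]
  congr 1
  ext y
  simp only [Set.mem_ofPred_eq, List.length_ofFn, Set.mem_preimage, Set.mem_singleton_iff, win,
    zero_add]
  exact List.ofFn_inj

/-- The frequencies of the words of length `p.length + 1` are determined by the measures of the
towers. -/
theorem IsStage.fr_eq_sum_occ {p : Word} {W : Fin 3 → Word} {x l : Fin 3 → Letter} {L : Set Word}
    {μ : Measure (ℕ → Letter)} (hs : IsStage p W x l) (hc : Codes L W)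
    (hμ : IsInvariantProbability L μ)
    (hone : ∑ i, ((W i).length : ℝ) * fr μ (p ++ W i) = 1) (f : Fin (p.length + 1) → Letter) :
    fr μ (List.ofFn f) = ∑ i, occ p W (List.ofFn f) i * fr μ (p ++ W i) := by
  have hsum : ∑ f : Fin (p.length + 1) → Letter, fr μ (List.ofFn f) =
      ∑ f : Fin (p.length + 1) → Letter, ∑ i, occ p W (List.ofFn f) i * fr μ (p ++ W i) := by
    rw [hμ.sum_fr, Finset.sum_comm, ← hone]
    refine Finset.sum_congr rfl fun i _ => ?_
    rw [← Finset.sum_mul, ← sum_occ p W i]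
    push_cast
    rfl
  -- Both sides have sum 1 over all words of this length, so every termwise inequality is an
  -- equality.
  exact (Finset.sum_eq_sum_iff_of_le fun f _ => hs.fr_le_sum_occ hc hμ (by simp)).1 hsum f
    (Finset.mem_univ f)

/-- Frequencies of words of arbitrarily large lengths fix all the finite marginals, and a measure on
the product is the unique projective limit of its marginals. -/
theorem measure_ext_of_fr {μ ν : Measure (ℕ → Letter)} [IsProbabilityMeasure μ]
    [IsProbabilityMeasure ν]
    (h : ∀ n, ∃ m, n ≤ m ∧ ∀ f : Fin m → Letter, fr μ (List.ofFn f) = fr ν (List.ofFn f)) :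
    μ = ν := by
  have key : ∀ n, μ.map (fun (y : ℕ → Letter) (i : Fin n) => y i) =
      ν.map (fun (y : ℕ → Letter) (i : Fin n) => y i) := by
    intro n
    obtain ⟨m, hnm, hm⟩ := h n
    have hmeas : ∀ n, Measurable (fun (y : ℕ → Letter) (i : Fin n) => y i) := fun n =>
      measurable_pi_lambda _ fun i => measurable_pi_apply _
    have hm' : μ.map (fun (y : ℕ → Letter) (i : Fin m) => y i) =
        ν.map (fun (y : ℕ → Letter) (i : Fin m) => y i) := by
      refine Measure.ext_of_singleton fun f => ?_
      rw [Measure.map_apply (hmeas m) (measurableSet_singleton f),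
        Measure.map_apply (hmeas m) (measurableSet_singleton f),
        ← ENNReal.toReal_eq_toReal_iff' (measure_ne_top _ _) (measure_ne_top _ _)]
      have e : (fun (y : ℕ → Letter) (i : Fin m) => y i) ⁻¹' {f} =
          {y | win y 0 (List.ofFn f).length = List.ofFn f} := by
        ext y
        simp only [Set.mem_ofPred_eq, List.length_ofFn, Set.mem_preimage, Set.mem_singleton_iff, win,
          zero_add]
        exact List.ofFn_inj.symm
      rw [e]
      exact hm f
    have e : (fun (y : ℕ → Letter) (i : Fin n) => y i) =
        (fun (g : Fin m → Letter) (i : Fin n) => g (i.castLE hnm)) ∘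
          (fun (y : ℕ → Letter) (i : Fin m) => y i) := rfl
    rw [e, ← Measure.map_map (measurable_of_countable _) (hmeas m), hm',
      Measure.map_map (measurable_of_countable _) (hmeas m)]
  refine IsProjectiveLimit.unique (P := fun I : Finset ℕ => ν.map I.restrict) ?_ (fun I => rfl)
  intro I
  obtain ⟨n, hn⟩ : ∃ n, ∀ i ∈ I, i < n := ⟨I.sup id + 1, fun i hi =>
    Nat.lt_succ_of_le (Finset.le_sup (f := id) hi)⟩
  have e : (I.restrict : (ℕ → Letter) → (I → Letter)) =
      (fun (g : Fin n → Letter) (i : I) => g ⟨i, hn i i.2⟩) ∘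
        (fun (y : ℕ → Letter) (i : Fin n) => y i) := rfl
  have hmeas : Measurable (fun (y : ℕ → Letter) (i : Fin n) => y i) :=
    measurable_pi_lambda _ fun i => measurable_pi_apply _
  show μ.map I.restrict = ν.map I.restrict
  rw [e, ← Measure.map_map (measurable_of_countable _) hmeas, key,
    Measure.map_map (measurable_of_countable _) hmeas]

end ArnouxRauzy

/-! ### Existence of an invariant measure -/

namespace ArnouxRauzy

/-- The empirical measure of the first `N + 1` points of the orbit of `y`. -/
noncomputable def empirical (y : ℕ → Letter) (N : ℕ) : Measure (ℕ → Letter) :=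
  ((N + 1 : ℕ) : ℝ≥0∞)⁻¹ • ∑ i ∈ Finset.range (N + 1), Measure.dirac (shift^[i] y)

theorem empirical_apply (y : ℕ → Letter) (N : ℕ) {A : Set (ℕ → Letter)} (hA : MeasurableSet A) :
    empirical y N A =
      ((N + 1 : ℕ) : ℝ≥0∞)⁻¹ * ∑ i ∈ Finset.range (N + 1), A.indicator 1 (shift^[i] y) := by
  simp only [empirical, Measure.smul_apply, Measure.finsetSum_apply, smul_eq_mul,
    Measure.dirac_apply' _ hA]

theorem empirical_of_forall (y : ℕ → Letter) (N : ℕ) {A : Set (ℕ → Letter)}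
    (hA : MeasurableSet A) (h : ∀ i, shift^[i] y ∈ A) : empirical y N A = 1 := by
  rw [empirical_apply y N hA, Finset.sum_congr rfl fun i _ => Set.indicator_of_mem (h i) _]
  simp only [Pi.one_apply, Finset.sum_const, Finset.card_range, nsmul_eq_mul, mul_one]
  exact ENNReal.inv_mul_cancel (by simp) (ENNReal.natCast_ne_top _)

instance (y : ℕ → Letter) (N : ℕ) : IsProbabilityMeasure (empirical y N) :=
  ⟨empirical_of_forall y N MeasurableSet.univ fun _ => Set.mem_univ _⟩

theorem measurable_shift : Measurable shift :=
  measurable_pi_lambda _ fun i => measurable_pi_apply (i + 1)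

/-- The difference telescopes to two end terms. -/
theorem empirical_preimage_shift (y : ℕ → Letter) (N : ℕ) {A : Set (ℕ → Letter)}
    (hA : MeasurableSet A) :
    |(empirical y N).real (shift ⁻¹' A) - (empirical y N).real A| ≤ 1 / ((N : ℝ) + 1) := by
  classical
  have h : ∀ {B : Set (ℕ → Letter)}, MeasurableSet B → (empirical y N).real B =
      ((N : ℝ) + 1)⁻¹ * ∑ i ∈ Finset.range (N + 1), B.indicator (1 : (ℕ → Letter) → ℝ) (shift^[i] y) := by
    intro B hB
    rw [Measure.real, empirical_apply y N hB, ENNReal.toReal_mul, ENNReal.toReal_inv,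
      ENNReal.toReal_natCast, ENNReal.toReal_sum]
    · push_cast
      congr 1
      refine Finset.sum_congr rfl fun i _ => ?_
      by_cases hi : shift^[i] y ∈ B <;> simp [hi]
    · intro i _
      by_cases hi : shift^[i] y ∈ B <;> simp [hi]
  have e : ∀ i, (shift ⁻¹' A).indicator (1 : (ℕ → Letter) → ℝ) (shift^[i] y) =
      A.indicator 1 (shift^[i + 1] y) := by
    intro i
    rw [Function.iterate_succ_apply']
    by_cases hi : shift (shift^[i] y) ∈ A <;> simp [hi]
  rw [h hA, h (measurable_shift hA), ← mul_sub, Finset.sum_congr rfl fun i _ => e i,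
    Finset.sum_range_succ, Finset.sum_range_succ' (fun i => A.indicator (1 : (ℕ → Letter) → ℝ) (shift^[i] y)),
    add_sub_add_left_eq_sub, abs_mul, abs_of_pos (by positivity : (0 : ℝ) < ((N : ℝ) + 1)⁻¹),
    one_div]
  apply mul_le_of_le_one_right (by positivity)
  by_cases h₁ : shift^[N + 1] y ∈ A <;> by_cases h₂ : shift^[0] y ∈ A <;>
    simp only [h₁, h₂, Set.indicator_of_mem, Set.indicator_of_notMem, not_false_eq_true,
      Pi.one_apply] <;> norm_num

/-- A symbolic space that contains a sequence carries an invariant probability measure. -/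
theorem exists_isInvariantProbability {L : Set Word} {y : ℕ → Letter}
    (hy : y ∈ symbolicSpace L) : ∃ μ, IsInvariantProbability L μ := by
  let P : ℕ → ProbabilityMeasure (ℕ → Letter) := fun N => ⟨empirical y N, inferInstance⟩
  -- Krylov–Bogolyubov argument, along an ultrafilter. Cylinder conditions are clopen, so their
  -- measures pass to the limit.
  obtain ⟨μ, -, hμ⟩ := isCompact_univ.ultrafilter_le_nhds ((hyperfilter ℕ).map P) (by simp)
  have hlim : Tendsto P (hyperfilter ℕ) (nhds μ) := hμ
  have hclopen : ∀ {A : Set (ℕ → Letter)}, IsClopen A →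
      Tendsto (fun N => (empirical y N).real A) (hyperfilter ℕ)
        (nhds ((μ : Measure (ℕ → Letter)).real A)) := by
    intro A hA
    have := (NNReal.tendsto_coe.2
      (ProbabilityMeasure.tendsto_measure_of_isClopen_of_tendsto hlim hA))
    exact this
  have hN : Tendsto (fun N : ℕ => 1 / ((N : ℝ) + 1)) (hyperfilter ℕ) (nhds 0) :=
    tendsto_one_div_add_atTop_nhds_zero_nat.mono_left Nat.hyperfilter_le_atTop
  have hpre : ∀ {A : Set (ℕ → Letter)}, IsClopen A →
      (μ : Measure (ℕ → Letter)).real (shift ⁻¹' A) = (μ : Measure (ℕ → Letter)).real A := by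
    intro A hA
    have hs : Continuous shift := continuous_pi fun i => continuous_apply (i + 1)
    have h₁ := (hclopen (hA.preimage hs)).sub (hclopen hA)
    have h₂ : Tendsto (fun N => (empirical y N).real (shift ⁻¹' A) - (empirical y N).real A)
        (hyperfilter ℕ) (nhds 0) := squeeze_zero_norm (fun N => by
      rw [Real.norm_eq_abs]
      exact empirical_preimage_shift y N hA.isOpen.measurableSet) hN
    exact sub_eq_zero.1 (tendsto_nhds_unique h₁ h₂)
  refine ⟨μ, inferInstance, ?_, ?_⟩
  · have h : (symbolicSpace L)ᶜ ⊆ ⋃ r : ℕ, ⋃ m : ℕ, {z | win z r m ∈ L}ᶜ := by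
      intro z hz
      simp only [symbolicSpace, Set.mem_compl_iff, Set.mem_ofPred_eq, not_forall] at hz
      simpa [win] using hz
    refine measure_mono_null h (measure_iUnion_null fun r => measure_iUnion_null fun m => ?_)
    have hc := isClopen_win r m L
    have h₁ := hclopen hc
    have h₂ : (fun N => (empirical y N).real {z | win z r m ∈ L}) = fun _ => 1 := by
      funext N
      rw [Measure.real, empirical_of_forall y N (measurableSet_win r m L) fun i => ?_,
        ENNReal.toReal_one]
      rw [Set.mem_ofPred_eq, win_shift]
      exact hy _ _
    rw [h₂] at h₁
    have h₃ := tendsto_nhds_unique h₁ tendsto_const_nhds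
    rw [prob_compl_eq_zero_iff (measurableSet_win r m L)]
    rw [Measure.real, ENNReal.toReal_eq_one_iff] at h₃
    exact h₃
  · refine ⟨measurable_shift, ?_⟩
    have : IsProbabilityMeasure ((μ : Measure (ℕ → Letter)).map shift) :=
      Measure.isProbabilityMeasure_map measurable_shift.aemeasurable
    refine measure_ext_of_fr fun n => ⟨n, le_rfl, fun f => ?_⟩
    rw [fr, fr, map_measureReal_apply measurable_shift (measurableSet_win_eq _ _ _)]
    exact hpre (isClopen_win 0 _ {List.ofFn f})

end ArnouxRauzy

/-! ### The levels of an Arnoux–Rauzy system -/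

namespace ArnouxRauzy

theorem wordPow_succ (w : Word) (t : ℕ) : wordPow w (t + 1) = wordPow w t ++ w := by
  simp [wordPow, List.replicate_succ']

@[simp] theorem wordPow_zero (w : Word) : wordPow w 0 = [] := rfl

@[simp] theorem length_wordPow (w : Word) (t : ℕ) : (wordPow w t).length = t * w.length := by
  simp [wordPow]

theorem addStep_iterate (W : Fin 3 → Word) (t : ℕ) :
    addStep^[t] W = fun i => if i = 0 then W 0 else W i ++ wordPow (W 0) t := by
  induction t with
  | zero => funext i; by_cases hi : i = 0 <;> simp [hi]
  | succ t ih =>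
    rw [Function.iterate_succ_apply', ih]
    funext i
    by_cases hi : i = 0 <;> simp [hi, addStep, wordPow_succ]

theorem IsStage.iterate {p : Word} {W : Fin 3 → Word} {x l : Fin 3 → Letter}
    (hs : IsStage p W x l) (t : ℕ) :
    IsStage (p ++ wordPow (W 0) t) (ArnouxRauzy.addStep^[t] W) x l := by
  induction t with
  | zero => simpa using hs
  | succ t ih =>
    have := ih.addStep
    rw [Function.iterate_succ_apply']
    rw [wordPow_succ, ← List.append_assoc]
    convert this using 2
    rw [addStep_iterate]
    simp

theorem exists_code_iterate (W : Fin 3 → Word) (t : ℕ) (i : Fin 3) :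
    ∃ c : List (Fin 3), addStep^[t] W i = c.flatMap W := by
  induction t generalizing i with
  | zero => exact ⟨[i], by simp⟩
  | succ t ih =>
    choose d hd using ih
    refine ⟨(addCode [i]).flatMap d, ?_⟩
    rw [Function.iterate_succ_apply', List.flatMap_assoc]
    simp only [← hd]
    rw [flatMap_addCode]
    simp

theorem Codes.of_iterate {L : Set Word} {W : Fin 3 → Word} {t k : ℕ} (htk : t ≤ k)
    (h : Codes L (addStep^[k] W)) : Codes L (addStep^[t] W) := by
  induction k, htk using Nat.le_induction with
  | base => exact h
  | succ k _ ih =>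
    rw [Function.iterate_succ_apply'] at h
    exact ih h.of_addStep

/-- `m` is one of the integers `n i`. -/
def IsMark (n : ℕ → ℕ) (m : ℕ) : Prop := ∃ i, 1 ≤ i ∧ n i = m

/-- The family `(H_m, G_m, J_m)`. -/
noncomputable def level (k n : ℕ → ℕ) (m : ℕ) : Fin 3 → Word :=
  ![(words k n m).1, (words k n m).2.1, (words k n m).2.2]

/-- The bispecial word of level `m`. -/
noncomputable def bispecial (k n : ℕ → ℕ) : ℕ → Word
  | 0 => []
  | m + 1 => bispecial k n m ++ wordPow (level k n m 0) (k (m + 1))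

theorem level_zero (k n : ℕ → ℕ) : level k n 0 = fun i => [i] := by
  funext i
  fin_cases i <;> rfl

open Classical in
/-- The permutation that follows the additive steps from level `m` to level `m + 1`. -/
noncomputable def levelPerm (n : ℕ → ℕ) (m : ℕ) : Equiv.Perm (Fin 3) :=
  if IsMark n (m + 1) then finRotate 3 else Equiv.swap 0 1

theorem level_succ (k n : ℕ → ℕ) (m : ℕ) :
    level k n (m + 1) = (addStep^[k (m + 1)] (level k n m)) ∘ levelPerm n m := by
  rw [addStep_iterate]
  funext i
  by_cases h : IsMark n (m + 1)
  · have h' : ∃ i, 1 ≤ i ∧ n i = m + 1 := h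
    have e : levelPerm n m = finRotate 3 := by simp [levelPerm, h]
    rw [Function.comp, e]
    simp only [level, words, if_pos h']
    fin_cases i <;> rfl
  · have h' : ¬ ∃ i, 1 ≤ i ∧ n i = m + 1 := h
    have e : levelPerm n m = Equiv.swap 0 1 := by simp [levelPerm, h]
    rw [Function.comp, e]
    simp only [level, words, if_neg h']
    fin_cases i <;> rfl

theorem levelPerm_of_isMark {n : ℕ → ℕ} {m : ℕ} (h : IsMark n (m + 1)) :
    levelPerm n m 0 = 1 ∧ levelPerm n m 1 = 2 ∧ levelPerm n m 2 = 0 := by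
  have e : levelPerm n m = finRotate 3 := by simp [levelPerm, h]
  rw [e]
  decide

theorem levelPerm_of_not_isMark {n : ℕ → ℕ} {m : ℕ} (h : ¬ IsMark n (m + 1)) :
    levelPerm n m 0 = 1 ∧ levelPerm n m 1 = 0 ∧ levelPerm n m 2 = 2 := by
  have e : levelPerm n m = Equiv.swap 0 1 := by simp [levelPerm, h]
  rw [e]
  decide

theorem exists_isStage (k n : ℕ → ℕ) (m : ℕ) :
    ∃ x l, IsStage (bispecial k n m) (level k n m) x l := by
  induction m with
  | zero => exact ⟨id, id, by rw [level_zero]; exact IsStage.zero⟩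
  | succ m ih =>
    obtain ⟨x, l, hs⟩ := ih
    rw [level_succ]
    exact ⟨_, _, (hs.iterate (k (m + 1))).perm (levelPerm n m)⟩

theorem exists_code_level (k n : ℕ → ℕ) {m M : ℕ} (h : m ≤ M) (i : Fin 3) :
    ∃ c : List (Fin 3), level k n M i = c.flatMap (level k n m) := by
  induction M, h using Nat.le_induction generalizing i with
  | base => exact ⟨[i], by simp⟩
  | succ M _ ih =>
    choose d hd using ih
    obtain ⟨c, hc⟩ := exists_code_iterate (level k n M) (k (M + 1)) (levelPerm n M i)
    refine ⟨c.flatMap d, ?_⟩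
    rw [level_succ, Function.comp, hc, List.flatMap_assoc]
    simp only [← hd]

theorem mem_language_of_infix {k n : ℕ → ℕ} {u w : Word} (h : u <:+: w)
    (hw : w ∈ language k n) : u ∈ language k n := by
  obtain ⟨m, hm⟩ := hw
  exact ⟨m, h.trans hm⟩

theorem level_zero_mem (k n : ℕ → ℕ) (m : ℕ) : level k n m 0 ∈ language k n :=
  ⟨m, List.infix_rfl⟩

namespace IsParameter

variable {k n : ℕ → ℕ}

theorem exists_k (hp : IsParameter k n) (m : ℕ) : ∃ t, k (m + 1) = t + 1 :=
  ⟨k (m + 1) - 1, by have := hp.one_le_k (m + 1) (by omega); omega⟩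

theorem level_succ_zero (k n : ℕ → ℕ) (m : ℕ) :
    level k n (m + 1) 0 = level k n m 1 ++ wordPow (level k n m 0) (k (m + 1)) := by
  rw [level_succ, addStep_iterate, Function.comp]
  by_cases h : IsMark n (m + 1)
  · simp [(levelPerm_of_isMark h).1]
  · simp [(levelPerm_of_not_isMark h).1]

theorem level_infix_succ (hp : IsParameter k n) (m : ℕ) :
    level k n m 0 <:+: level k n (m + 1) 0 := by
  obtain ⟨t, ht⟩ := hp.exists_k m
  rw [level_succ_zero, ht, wordPow_succ, ← List.append_assoc]
  exact (List.suffix_append _ _).isInfix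

theorem level_infix (hp : IsParameter k n) {m M : ℕ} (h : m ≤ M) :
    level k n m 0 <:+: level k n M 0 := by
  induction M, h using Nat.le_induction with
  | base => exact List.infix_rfl
  | succ M _ ih => exact ih.trans (hp.level_infix_succ M)

theorem codes (hp : IsParameter k n) (m : ℕ) : Codes (language k n) (level k n m) := by
  rintro u ⟨M, hM⟩
  obtain h | h := le_total m M
  · obtain ⟨c, hc⟩ := exists_code_level k n h 0
    exact ⟨c, hc ▸ hM⟩
  · refine ⟨[0], ?_⟩
    have : u <:+: level k n m 0 := List.IsInfix.trans hM (hp.level_infix h)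
    simpa using this

theorem codes_iterate (hp : IsParameter k n) (m : ℕ) {t : ℕ} (ht : t ≤ k (m + 1)) :
    Codes (language k n) (addStep^[t] (level k n m)) := by
  refine Codes.of_iterate ht ((hp.codes (m + 1)).of_words fun i => ⟨[levelPerm n m i], ?_⟩)
  rw [level_succ]
  simp

theorem length_level_pos (k n : ℕ → ℕ) (m : ℕ) (i : Fin 3) : 0 < (level k n m i).length := by
  obtain ⟨x, l, hs⟩ := exists_isStage k n m
  exact hs.length_pos i

theorem lt_length_level (hp : IsParameter k n) (m : ℕ) : m < (level k n m 0).length := by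
  induction m with
  | zero => exact length_level_pos k n 0 0
  | succ m ih =>
    obtain ⟨t, ht⟩ := hp.exists_k m
    have := length_level_pos k n m 1
    rw [level_succ_zero, List.length_append, length_wordPow, ht]
    nlinarith

theorem le_length_bispecial (hp : IsParameter k n) (m : ℕ) : m ≤ (bispecial k n m).length := by
  induction m with
  | zero => simp
  | succ m ih =>
    obtain ⟨t, ht⟩ := hp.exists_k m
    have := length_level_pos k n m 0
    rw [bispecial, List.length_append, length_wordPow, ht]
    nlinarith

/-- The word p_m is a suffix of p_m H_M for M ≥ m, hence of H_M itself once H_M is longer than p_m.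
-/
theorem bispecial_mem (hp : IsParameter k n) (m : ℕ) : bispecial k n m ∈ language k n := by
  obtain ⟨x, l, hs⟩ := exists_isStage k n m
  set M := max m (bispecial k n m).length with hM
  obtain ⟨c, hc⟩ := exists_code_level k n (le_max_left m (bispecial k n m).length) 0
  rw [← hM] at hc
  obtain ⟨s, h⟩ := hs.suffix c
  rw [← hc] at h
  have hlen := hp.lt_length_level M
  have : bispecial k n m <:+ level k n M 0 :=
    List.suffix_of_suffix_length_le ⟨s, rfl⟩ ⟨bispecial k n m, h⟩
      (by have := le_max_right m (bispecial k n m).length; omega)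
  exact mem_language_of_infix this.isInfix (level_zero_mem k n M)

theorem bispecial_prefix (k n : ℕ → ℕ) {m M : ℕ} (h : m ≤ M) :
    bispecial k n m <+: bispecial k n M := by
  induction M, h using Nat.le_induction with
  | base => exact List.prefix_rfl
  | succ M _ ih => exact ih.trans (List.prefix_append _ _)

/-- The bispecial words are prefixes of one another; their limit is a point of the system. -/
theorem exists_mem_symbolicSpace (hp : IsParameter k n) :
    ∃ y, y ∈ symbolicSpace (language k n) := by
  refine ⟨fun i => (bispecial k n (i + 1)).getD i 0, fun r m => ?_⟩
  refine mem_language_of_infix ?_ (hp.bispecial_mem (r + m))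
  have : (List.ofFn fun i : Fin m => (bispecial k n (r + i + 1)).getD (r + i) 0) =
      ((bispecial k n (r + m)).drop r).take m := by
    have h₁ := hp.le_length_bispecial (r + m)
    apply List.ext_getElem
    · simp; omega
    · intro i hi _
      simp only [List.length_ofFn] at hi
      have h₂ := hp.le_length_bispecial (r + i + 1)
      simp only [List.getElem_ofFn, List.getElem_take, List.getElem_drop]
      rw [List.getD_eq_getElem _ _ (by omega)]
      exact List.IsPrefix.getElem (bispecial_prefix k n (by omega)) (by omega)
  rw [this]
  exact (List.take_prefix _ _).isInfix.trans (List.drop_suffix _ _).isInfix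

end IsParameter

/-- The measures of the three towers of level `m`. -/
noncomputable def towerFr (μ : Measure (ℕ → Letter)) (k n : ℕ → ℕ) (m : ℕ) (i : Fin 3) : ℝ :=
  fr μ (bispecial k n m ++ level k n m i)

theorem towerFr_nonneg (μ : Measure (ℕ → Letter)) (k n : ℕ → ℕ) (m : ℕ) (i : Fin 3) :
    0 ≤ towerFr μ k n m i := fr_nonneg _ _

section

variable {k n : ℕ → ℕ} {μ : Measure (ℕ → Letter)}

/-- Each additive step keeps the measures of indices 1 and 2 and subtracts their sum from that of
index 0. -/
theorem IsParameter.towerFr_iterate (hp : IsParameter k n)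
    (hμ : IsInvariantProbability (language k n) μ) (m : ℕ) {t : ℕ} (ht : t ≤ k (m + 1)) :
    (∀ i, i ≠ 0 → fr μ (bispecial k n m ++ wordPow (level k n m 0) t ++
      addStep^[t] (level k n m) i) = towerFr μ k n m i) ∧
    towerFr μ k n m 0 = fr μ (bispecial k n m ++ wordPow (level k n m 0) t ++
      addStep^[t] (level k n m) 0) + t * (towerFr μ k n m 1 + towerFr μ k n m 2) := by
  obtain ⟨x, l, hs⟩ := exists_isStage k n m
  induction t with
  | zero => simp [towerFr]
  | succ t ih =>
    obtain ⟨h₁, h₂⟩ := ih (by omega)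
    have hs' := hs.iterate t
    have hc := hp.codes_iterate m ht
    rw [Function.iterate_succ_apply'] at hc ⊢
    have e : addStep^[t] (level k n m) 0 = level k n m 0 := by rw [addStep_iterate]; simp
    have e' : bispecial k n m ++ wordPow (level k n m 0) (t + 1) =
        bispecial k n m ++ wordPow (level k n m 0) t ++ addStep^[t] (level k n m) 0 := by
      rw [e, wordPow_succ, List.append_assoc]
    rw [e']
    refine ⟨fun i hi => by rw [hs'.fr_addStep hc hμ hi, h₁ i hi], ?_⟩
    rw [h₂, hs'.fr_addStep_zero hc hμ, h₁ 1 (by decide), h₁ 2 (by decide)]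
    push_cast
    ring

theorem towerFr_succ (k n : ℕ → ℕ) (μ : Measure (ℕ → Letter)) (m : ℕ) (i : Fin 3) :
    towerFr μ k n (m + 1) i = fr μ (bispecial k n m ++ wordPow (level k n m 0) (k (m + 1)) ++
      addStep^[k (m + 1)] (level k n m) (levelPerm n m i)) := by
  rw [towerFr, level_succ]; rfl

end

/-- The recursion satisfied by the lengths of the words `H_m, G_m, J_m`. -/
structure LengthRec (k : ℕ → ℕ) (R : ℕ → Prop) (h g j : ℕ → ℝ) : Prop where
  h_succ : ∀ m, h (m + 1) = g m + k (m + 1) * h m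
  one : ∀ m, R (m + 1) → g (m + 1) = j m + k (m + 1) * h m ∧ j (m + 1) = h m
  two : ∀ m, ¬ R (m + 1) → g (m + 1) = h m ∧ j (m + 1) = j m + k (m + 1) * h m

/-- The recursion satisfied by the measures of the towers. -/
structure FreqRec (k : ℕ → ℕ) (R : ℕ → Prop) (a b c : ℕ → ℝ) : Prop where
  a_succ : ∀ m, a (m + 1) = b m
  one : ∀ m, R (m + 1) → b (m + 1) = c m ∧ a m = k (m + 1) * (b m + c m) + c (m + 1)
  two : ∀ m, ¬ R (m + 1) → c (m + 1) = c m ∧ a m = k (m + 1) * (b m + c m) + b (m + 1)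

/-- Serves for the length and also, in the proof of uniqueness, for the number of occurrences of a
letter. -/
theorem lengthRec_of_additive (k n : ℕ → ℕ) (φ : Word → ℕ)
    (hφ : ∀ u v, φ (u ++ v) = φ u + φ v) :
    LengthRec k (IsMark n) (fun m => φ (level k n m 0)) (fun m => φ (level k n m 1))
      (fun m => φ (level k n m 2)) := by
  have hnil : φ [] = 0 := by simpa using hφ [] []
  have hpow : ∀ (w : Word) (t : ℕ), φ (wordPow w t) = t * φ w := by
    intro w t
    induction t with
    | zero => simp [hnil]
    | succ t ih => rw [wordPow_succ, hφ, ih]; ring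
  have e : ∀ m i, φ (level k n (m + 1) i) = φ (if levelPerm n m i = 0 then level k n m 0 else
      level k n m (levelPerm n m i) ++ wordPow (level k n m 0) (k (m + 1))) := by
    intro m i
    rw [level_succ, addStep_iterate]; rfl
  refine ⟨fun m => ?_, fun m h => ?_, fun m h => ?_⟩
  · have : levelPerm n m 0 = 1 := by
      by_cases h : IsMark n (m + 1)
      · exact (levelPerm_of_isMark h).1
      · exact (levelPerm_of_not_isMark h).1
    simp only [e, this]
    simp [hφ, hpow]
  · obtain ⟨-, h₁, h₂⟩ := levelPerm_of_isMark h
    simp only [e, h₁, h₂]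
    simp [hφ, hpow]
  · obtain ⟨-, h₁, h₂⟩ := levelPerm_of_not_isMark h
    simp only [e, h₁, h₂]
    simp [hφ, hpow]

theorem IsParameter.freqRec {k n : ℕ → ℕ} {μ : Measure (ℕ → Letter)} (hp : IsParameter k n)
    (hμ : IsInvariantProbability (language k n) μ) :
    FreqRec k (IsMark n) (fun m => towerFr μ k n m 0) (fun m => towerFr μ k n m 1)
      (fun m => towerFr μ k n m 2) := by
  refine ⟨fun m => ?_, fun m h => ?_, fun m h => ?_⟩
  · obtain ⟨h₁, -⟩ := hp.towerFr_iterate hμ m le_rfl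
    have : levelPerm n m 0 = 1 := by
      by_cases h : IsMark n (m + 1)
      · exact (levelPerm_of_isMark h).1
      · exact (levelPerm_of_not_isMark h).1
    rw [towerFr_succ, this, h₁ 1 (by decide)]
  · obtain ⟨h₁, h₂⟩ := hp.towerFr_iterate hμ m le_rfl
    obtain ⟨-, e₁, e₂⟩ := levelPerm_of_isMark h
    rw [towerFr_succ, towerFr_succ, e₁, e₂, h₁ 2 (by decide)]
    exact ⟨rfl, by linarith⟩
  · obtain ⟨h₁, h₂⟩ := hp.towerFr_iterate hμ m le_rfl
    obtain ⟨-, e₁, e₂⟩ := levelPerm_of_not_isMark h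
    rw [towerFr_succ, towerFr_succ, e₁, e₂, h₁ 2 (by decide)]
    exact ⟨rfl, by linarith⟩

end ArnouxRauzy

/-! ### The dual recursions: contraction and uniqueness -/

namespace ArnouxRauzy

namespace LengthRec

variable {k : ℕ → ℕ} {R : ℕ → Prop} {h g j : ℕ → ℝ}

/-- The three quantities of a recursion step, up to the order of the last two. -/
theorem step (H : LengthRec k R h g j) (m : ℕ) :
    h (m + 1) = g m + k (m + 1) * h m ∧
      ((g (m + 1) = j m + k (m + 1) * h m ∧ j (m + 1) = h m) ∨
        (g (m + 1) = h m ∧ j (m + 1) = j m + k (m + 1) * h m)) := by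
  refine ⟨H.h_succ m, ?_⟩
  by_cases hR : R (m + 1)
  · exact Or.inl (H.one m hR)
  · exact Or.inr (H.two m hR)

/-- Consequence used below: g and j are at most 2h, which keeps the weights of the averages at most
2/3. -/
theorem bounds (H : LengthRec k R h g j) (hk : ∀ m, 1 ≤ m → 1 ≤ k m) (h0 : h 0 = 1) (g0 : g 0 = 1)
    (j0 : j 0 = 1) (m : ℕ) :
    0 < h m ∧ 0 < g m ∧ 0 < j m ∧ j m ≤ h m + g m ∧ g m ≤ h m + j m ∧
      (g m ≤ h m ∨ j m ≤ h m) := by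
  induction m with
  | zero => rw [h0, g0, j0]; norm_num
  | succ m ih =>
    obtain ⟨i₁, i₂, i₃, i₄, i₅, i₆⟩ := ih
    have hk' : (1 : ℝ) ≤ k (m + 1) := by exact_mod_cast hk (m + 1) (by omega)
    have hkh : h m ≤ k (m + 1) * h m := by nlinarith
    obtain ⟨e, ⟨e₁, e₂⟩ | ⟨e₁, e₂⟩⟩ := H.step m
    · rw [e, e₁, e₂]
      refine ⟨by linarith, by linarith, i₁, by linarith, by linarith, Or.inr (by linarith)⟩
    · rw [e, e₁, e₂]
      refine ⟨by linarith, i₁, by linarith, by linarith, by linarith, Or.inl (by linarith)⟩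

end LengthRec

/-- Two steps of the recursion contract the differences of three averages. -/
theorem two_step_contraction {D l v P Q S P₂ X₂ : ℝ} (hl0 : 0 ≤ l) (hl : l ≤ 2 / 3) (hv0 : 0 ≤ v)
    (hv : v ≤ 2 / 3) (hPQ : |P - Q| ≤ D) (hPS : |P - S| ≤ 2 / 3 * D) (hQS : |Q - S| ≤ D)
    (hP₂ : P₂ = l * Q + (1 - l) * P) (hX₂ : X₂ = v * S + (1 - v) * P) :
    |P₂ - P| ≤ 8 / 9 * D ∧ |X₂ - P| ≤ 8 / 9 * D ∧ |P₂ - X₂| ≤ 8 / 9 * D := by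
  subst hP₂ hX₂
  rw [abs_le] at hPQ hPS hQS
  obtain ⟨a₁, a₂⟩ := hPQ
  obtain ⟨b₁, b₂⟩ := hPS
  obtain ⟨c₁, c₂⟩ := hQS
  have hD : 0 ≤ D := by linarith
  simp only [abs_le]
  have m₁ : ∀ {t z : ℝ}, 0 ≤ t → t ≤ 2 / 3 → z ≤ D → t * z ≤ 2 / 3 * D := by
    intro t z h0 h1 h2
    nlinarith
  have q₁ := m₁ hl0 hl (show P - Q ≤ D by linarith)
  have q₂ := m₁ hl0 hl (show Q - P ≤ D by linarith)
  have q₃ := m₁ hv0 hv (show P - S ≤ D by linarith)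
  have q₄ := m₁ hv0 hv (show S - P ≤ D by linarith)
  refine ⟨⟨by linarith, by linarith⟩, ⟨by linarith, by linarith⟩, ?_, ?_⟩
  · have e : l * Q + (1 - l) * P - (v * S + (1 - v) * P) =
        l * (1 - v) * (Q - P) + l * v * (Q - S) + (1 - l) * v * (P - S) := by ring
    rw [e]
    have t₁ : 0 ≤ l * (1 - v) := mul_nonneg hl0 (by linarith)
    have t₂ : 0 ≤ l * v := mul_nonneg hl0 hv0
    have t₃ : 0 ≤ (1 - l) * v := mul_nonneg (by linarith) hv0
    have u₁ := mul_le_mul_of_nonneg_left (show -D ≤ Q - P by linarith) t₁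
    have u₂ := mul_le_mul_of_nonneg_left (show -D ≤ Q - S by linarith) t₂
    have u₃ := mul_le_mul_of_nonneg_left (show -(2 / 3 * D) ≤ P - S by linarith) t₃
    -- The distance is at most lD + (1 − l)(2/3)D = (2 + l)D/3, and l ≤ 2/3 gives the constant 8/9.
    have w₁ : (1 - l) * v * (2 / 3 * D) ≤ (1 - l) * (2 / 3 * D) := by
      have : 0 ≤ (1 - l) * (2 / 3 * D) := mul_nonneg (by linarith) (by linarith)
      nlinarith
    nlinarith
  · have e : l * Q + (1 - l) * P - (v * S + (1 - v) * P) =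
        l * (1 - v) * (Q - P) + l * v * (Q - S) + (1 - l) * v * (P - S) := by ring
    rw [e]
    have t₁ : 0 ≤ l * (1 - v) := mul_nonneg hl0 (by linarith)
    have t₂ : 0 ≤ l * v := mul_nonneg hl0 hv0
    have t₃ : 0 ≤ (1 - l) * v := mul_nonneg (by linarith) hv0
    have u₁ := mul_le_mul_of_nonneg_left (show Q - P ≤ D by linarith) t₁
    have u₂ := mul_le_mul_of_nonneg_left (show Q - S ≤ D by linarith) t₂
    have u₃ := mul_le_mul_of_nonneg_left (show P - S ≤ 2 / 3 * D by linarith) t₃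
    have w₁ : (1 - l) * v * (2 / 3 * D) ≤ (1 - l) * (2 / 3 * D) := by
      have : 0 ≤ (1 - l) * (2 / 3 * D) := mul_nonneg (by linarith) (by linarith)
      nlinarith
    nlinarith

/-- One step of the recursion for three averages. -/
theorem one_step_contraction {D l v P Q S P₁ X₁ : ℝ} (hl0 : 0 ≤ l) (hl : l ≤ 2 / 3) (hv0 : 0 ≤ v)
    (hv : v ≤ 2 / 3) (hPQ : |P - Q| ≤ D) (hPS : |P - S| ≤ D) (hQS : |Q - S| ≤ D)
    (hP₁ : P₁ = l * Q + (1 - l) * P) (hX₁ : X₁ = v * S + (1 - v) * P) :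
    |P₁ - P| ≤ 2 / 3 * D ∧ |X₁ - P| ≤ 2 / 3 * D ∧ |P₁ - X₁| ≤ D := by
  subst hP₁ hX₁
  have hD : 0 ≤ D := (abs_nonneg _).trans hPQ
  refine ⟨?_, ?_, ?_⟩
  · have e : l * Q + (1 - l) * P - P = l * -(P - Q) := by ring
    rw [e, abs_mul, abs_neg, abs_of_nonneg hl0]
    nlinarith [abs_nonneg (P - Q)]
  · have e : v * S + (1 - v) * P - P = v * -(P - S) := by ring
    rw [e, abs_mul, abs_neg, abs_of_nonneg hv0]
    nlinarith [abs_nonneg (P - S)]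
  · rw [abs_le] at hPQ hPS hQS ⊢
    obtain ⟨a₁, a₂⟩ := hPQ
    obtain ⟨b₁, b₂⟩ := hPS
    obtain ⟨c₁, c₂⟩ := hQS
    have e : l * Q + (1 - l) * P - (v * S + (1 - v) * P) =
        l * (1 - v) * (Q - P) + l * v * (Q - S) + (1 - l) * v * (P - S) := by ring
    rw [e]
    have t₁ : 0 ≤ l * (1 - v) := mul_nonneg hl0 (by linarith)
    have t₂ : 0 ≤ l * v := mul_nonneg hl0 hv0
    have t₃ : 0 ≤ (1 - l) * v := mul_nonneg (by linarith) hv0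
    have t₄ : l * (1 - v) + l * v + (1 - l) * v ≤ 1 := by nlinarith
    have t₅ := mul_le_mul_of_nonneg_right t₄ hD
    constructor
    · have u₁ := mul_le_mul_of_nonneg_left (show -D ≤ Q - P by linarith) t₁
      have u₂ := mul_le_mul_of_nonneg_left (show -D ≤ Q - S by linarith) t₂
      have u₃ := mul_le_mul_of_nonneg_left (show -D ≤ P - S by linarith) t₃
      nlinarith
    · have u₁ := mul_le_mul_of_nonneg_left (show Q - P ≤ D by linarith) t₁
      have u₂ := mul_le_mul_of_nonneg_left (show Q - S ≤ D by linarith) t₂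
      have u₃ := mul_le_mul_of_nonneg_left (show P - S ≤ D by linarith) t₃
      nlinarith

theorem average_step {g h k A B : ℝ} (hg : 0 < g) (hh : 0 < h) (hk : 1 ≤ k) (hgh : g ≤ 2 * h) :
    0 ≤ g / (g + k * h) ∧ g / (g + k * h) ≤ 2 / 3 ∧
      (B + k * A) / (g + k * h) = g / (g + k * h) * (B / g) + (1 - g / (g + k * h)) * (A / h) := by
  have hpos : 0 < g + k * h := by positivity
  refine ⟨by positivity, ?_, by field_simp; ring⟩
  rw [div_le_div_iff₀ hpos (by norm_num)]
  nlinarith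

/-- The averages of an additive quantity over the three words of a level get close to each
other. -/
theorem LengthRec.contraction {k : ℕ → ℕ} {R : ℕ → Prop} {h g j A B C : ℕ → ℝ}
    (H : LengthRec k R h g j) (H' : LengthRec k R A B C) (hk : ∀ m, 1 ≤ m → 1 ≤ k m)
    (h0 : h 0 = 1) (g0 : g 0 = 1) (j0 : j 0 = 1) {D : ℝ} (hAB : |A 0 - B 0| ≤ D)
    (hAC : |A 0 - C 0| ≤ D) (hBC : |B 0 - C 0| ≤ D) (N : ℕ) :
    |A (2 * N) / h (2 * N) - B (2 * N) / g (2 * N)| ≤ (8 / 9) ^ N * D ∧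
    |A (2 * N) / h (2 * N) - C (2 * N) / j (2 * N)| ≤ (8 / 9) ^ N * D ∧
    |B (2 * N) / g (2 * N) - C (2 * N) / j (2 * N)| ≤ (8 / 9) ^ N * D := by
  have key : ∀ m, ∃ l v : ℝ, 0 ≤ l ∧ l ≤ 2 / 3 ∧ 0 ≤ v ∧ v ≤ 2 / 3 ∧
      A (m + 1) / h (m + 1) = l * (B m / g m) + (1 - l) * (A m / h m) ∧
      ((B (m + 1) / g (m + 1) = v * (C m / j m) + (1 - v) * (A m / h m) ∧
        C (m + 1) / j (m + 1) = A m / h m) ∨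
      (C (m + 1) / j (m + 1) = v * (C m / j m) + (1 - v) * (A m / h m) ∧
        B (m + 1) / g (m + 1) = A m / h m)) := by
    intro m
    obtain ⟨p₁, p₂, p₃, p₄, p₅, p₆⟩ := H.bounds hk h0 g0 j0 m
    have hk' : (1 : ℝ) ≤ k (m + 1) := by exact_mod_cast hk (m + 1) (by omega)
    obtain ⟨q₁, q₂, q₃⟩ := average_step (A := A m) (B := B m) p₂ p₁ hk'
      (by rcases p₆ with p | p <;> linarith)
    obtain ⟨r₁, r₂, r₃⟩ := average_step (A := A m) (B := C m) p₃ p₁ hk'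
      (by rcases p₆ with p | p <;> linarith)
    refine ⟨_, _, q₁, q₂, r₁, r₂, by rw [H.h_succ, H'.h_succ, q₃], ?_⟩
    by_cases hR : R (m + 1)
    · left
      rw [(H.one m hR).1, (H.one m hR).2, (H'.one m hR).1, (H'.one m hR).2]
      exact ⟨r₃, rfl⟩
    · right
      rw [(H.two m hR).1, (H.two m hR).2, (H'.two m hR).1, (H'.two m hR).2]
      exact ⟨r₃, rfl⟩
  induction N with
  | zero => simp [h0, g0, j0, hAB, hAC, hBC]
  | succ N ih =>
    obtain ⟨i₁, i₂, i₃⟩ := ih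
    rw [show 2 * (N + 1) = 2 * N + 1 + 1 by ring,
      show ((8 : ℝ) / 9) ^ (N + 1) * D = 8 / 9 * ((8 / 9) ^ N * D) by ring]
    generalize ((8 : ℝ) / 9) ^ N * D = E at *
    -- After one step the three averages are two new means and the old average of H. Only the
    -- distance between the two new means may fail to shrink; the second step reduces it.
    obtain ⟨l, v, l0, l1, v0, v1, e, hcase⟩ := key (2 * N)
    obtain ⟨l', v', l0', l1', v0', v1', e', hcase'⟩ := key (2 * N + 1)
    set m := 2 * N with hm
    obtain ⟨e₁, e₂⟩ | ⟨e₁, e₂⟩ := hcase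
    · obtain ⟨a₁, a₂, a₃⟩ := one_step_contraction l0 l1 v0 v1 i₁ i₂ i₃ e e₁
      rw [← e₂] at a₁ a₂
      have hE : 0 ≤ E := (abs_nonneg _).trans a₃
      obtain ⟨e₁', e₂'⟩ | ⟨e₁', e₂'⟩ := hcase'
      · obtain ⟨b₁, b₂, b₃⟩ := two_step_contraction l0' l1' v0' v1' a₃ a₁ (by linarith) e' e₁'
        rw [← e₂'] at b₁ b₂
        exact ⟨b₃, b₁, b₂⟩
      · obtain ⟨b₁, b₂, b₃⟩ := two_step_contraction l0' l1' v0' v1' a₃ a₁ (by linarith) e' e₁'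
        rw [← e₂'] at b₁ b₂
        exact ⟨b₁, b₃, by rwa [abs_sub_comm]⟩
    · obtain ⟨a₁, a₂, a₃⟩ := one_step_contraction l0 l1 v0 v1 i₁ i₂ i₃ e e₁
      rw [← e₂] at a₁ a₂
      have hE : 0 ≤ E := (abs_nonneg _).trans a₃
      rw [abs_sub_comm] at a₂
      obtain ⟨e₁', e₂'⟩ | ⟨e₁', e₂'⟩ := hcase'
      · obtain ⟨b₁, b₂, b₃⟩ := two_step_contraction v0' v1' l0' l1' a₃ a₁
          (by rw [abs_sub_comm]; linarith) e₁' e'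
        rw [← e₂'] at b₁ b₂
        exact ⟨by rwa [abs_sub_comm], b₂, b₁⟩
      · obtain ⟨b₁, b₂, b₃⟩ := two_step_contraction v0' v1' l0' l1' a₃ a₁
          (by rw [abs_sub_comm]; linarith) e₁' e'
        rw [← e₂'] at b₁ b₂
        exact ⟨b₂, by rwa [abs_sub_comm], by rwa [abs_sub_comm]⟩

/-- Lengths and measures are dual to each other. -/
theorem LengthRec.pairing {k : ℕ → ℕ} {R : ℕ → Prop} {h g j a b c : ℕ → ℝ}
    (H : LengthRec k R h g j) (F : FreqRec k R a b c) (m : ℕ) :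
    h m * a m + g m * b m + j m * c m = h 0 * a 0 + g 0 * b 0 + j 0 * c 0 := by
  induction m with
  | zero => rfl
  | succ m ih =>
    rw [← ih, H.h_succ, F.a_succ]
    by_cases hR : R (m + 1)
    · rw [(H.one m hR).1, (H.one m hR).2, (F.one m hR).1, (F.one m hR).2]; ring
    · rw [(H.two m hR).1, (H.two m hR).2, (F.two m hR).1, (F.two m hR).2]; ring

/-- The recursion and the normalization determine the measures of the towers. -/
theorem FreqRec.ext {k : ℕ → ℕ} {R : ℕ → Prop} {a b c a' b' c' : ℕ → ℝ} (F : FreqRec k R a b c)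
    (F' : FreqRec k R a' b' c') (h0 : a 0 = a' 0 ∧ b 0 = b' 0 ∧ c 0 = c' 0) (m : ℕ) :
    a m = a' m ∧ b m = b' m ∧ c m = c' m := by
  induction m with
  | zero => exact h0
  | succ m ih =>
    obtain ⟨h₁, h₂, h₃⟩ := ih
    refine ⟨by rw [F.a_succ, F'.a_succ, h₂], ?_⟩
    by_cases hR : R (m + 1)
    · have e₁ := F.one m hR
      have e₂ := F'.one m hR
      rw [← h₁, ← h₂, ← h₃] at e₂
      exact ⟨e₁.1.trans e₂.1.symm, by linarith [e₁.2, e₂.2]⟩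
    · have e₁ := F.two m hR
      have e₂ := F'.two m hR
      rw [← h₁, ← h₂, ← h₃] at e₂
      exact ⟨by linarith [e₁.2, e₂.2], e₁.1.trans e₂.1.symm⟩

/-- By the normalization both values are weighted means of A/h, B/g, C/j, which lie close together.
-/
theorem pairing_sub_le {h g j A B C a b c a' b' c' E : ℝ} (hh : 0 < h) (hg : 0 < g) (hj : 0 < j)
    (ha : 0 ≤ a) (hb : 0 ≤ b) (hc : 0 ≤ c) (ha' : 0 ≤ a') (hb' : 0 ≤ b') (hc' : 0 ≤ c')
    (n₁ : h * a + g * b + j * c = 1) (n₂ : h * a' + g * b' + j * c' = 1)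
    (c₁ : |A / h - B / g| ≤ E) (c₂ : |A / h - C / j| ≤ E) :
    |A * a + B * b + C * c - (A * a' + B * b' + C * c')| ≤ E * 2 := by
  obtain ⟨P, rfl⟩ : ∃ P, A = P * h := ⟨A / h, by field_simp⟩
  obtain ⟨Q, rfl⟩ : ∃ Q, B = Q * g := ⟨B / g, by field_simp⟩
  obtain ⟨S, rfl⟩ : ∃ S, C = S * j := ⟨C / j, by field_simp⟩
  rw [mul_div_cancel_right₀ _ hh.ne', mul_div_cancel_right₀ _ hg.ne'] at c₁
  rw [mul_div_cancel_right₀ _ hh.ne', mul_div_cancel_right₀ _ hj.ne'] at c₂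
  have hE : 0 ≤ E := (abs_nonneg _).trans c₁
  have bound : ∀ u w : ℝ, 0 ≤ u → 0 ≤ w → u + w ≤ 1 → |(P - Q) * u + (P - S) * w| ≤ E := by
    intro u w hu hw huw
    refine (abs_add_le _ _).trans ?_
    rw [abs_mul, abs_mul, abs_of_nonneg hu, abs_of_nonneg hw]
    have t₁ := mul_le_mul_of_nonneg_right c₁ hu
    have t₂ := mul_le_mul_of_nonneg_right c₂ hw
    have t₃ := mul_le_mul_of_nonneg_left huw hE
    linarith
  have e : P * h * a + Q * g * b + S * j * c - (P * h * a' + Q * g * b' + S * j * c') =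
      -((P - Q) * (g * b) + (P - S) * (j * c)) + ((P - Q) * (g * b') + (P - S) * (j * c')) := by
    linear_combination P * n₁ - P * n₂
  have b₁ := bound (g * b) (j * c) (by positivity) (by positivity)
    (by linarith [mul_nonneg hh.le ha])
  have b₂ := bound (g * b') (j * c') (by positivity) (by positivity)
    (by linarith [mul_nonneg hh.le ha'])
  rw [e]
  refine (abs_add_le _ _).trans ?_
  rw [abs_neg]
  linarith

/-- If all averages of an additive quantity get close to each other, its value is the same for
all normalized solutions of the recursion. -/
theorem pairing_unique {k : ℕ → ℕ} {R : ℕ → Prop} {h g j A B C a b c a' b' c' : ℕ → ℝ}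
    (H : LengthRec k R h g j) (H' : LengthRec k R A B C) (hk : ∀ m, 1 ≤ m → 1 ≤ k m)
    (h0 : h 0 = 1) (g0 : g 0 = 1) (j0 : j 0 = 1)
    (F : FreqRec k R a b c) (F' : FreqRec k R a' b' c')
    (hF : ∀ m, 0 ≤ a m ∧ 0 ≤ b m ∧ 0 ≤ c m) (hF' : ∀ m, 0 ≤ a' m ∧ 0 ≤ b' m ∧ 0 ≤ c' m)
    (hn : a 0 + b 0 + c 0 = 1) (hn' : a' 0 + b' 0 + c' 0 = 1) :
    A 0 * a 0 + B 0 * b 0 + C 0 * c 0 = A 0 * a' 0 + B 0 * b' 0 + C 0 * c' 0 := by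
  obtain ⟨D, d₁, d₂, d₃⟩ : ∃ D : ℝ, |A 0 - B 0| ≤ D ∧ |A 0 - C 0| ≤ D ∧ |B 0 - C 0| ≤ D := by
    have t₁ := abs_nonneg (A 0 - B 0)
    have t₂ := abs_nonneg (A 0 - C 0)
    have t₃ := abs_nonneg (B 0 - C 0)
    exact ⟨|A 0 - B 0| + |A 0 - C 0| + |B 0 - C 0|, by linarith, by linarith, by linarith⟩
  have key : ∀ N : ℕ, |A 0 * a 0 + B 0 * b 0 + C 0 * c 0 -
      (A 0 * a' 0 + B 0 * b' 0 + C 0 * c' 0)| ≤ (8 / 9) ^ N * (D * 2) := by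
    intro N
    obtain ⟨c₁, c₂, c₃⟩ := H.contraction H' hk h0 g0 j0 d₁ d₂ d₃ N
    rw [← mul_assoc, ← H'.pairing F (2 * N), ← H'.pairing F' (2 * N)]
    have n₁ := H.pairing F (2 * N)
    have n₂ := H.pairing F' (2 * N)
    rw [h0, g0, j0, one_mul, one_mul, one_mul] at n₁ n₂
    obtain ⟨p₁, p₂, p₃, -⟩ := H.bounds hk h0 g0 j0 (2 * N)
    obtain ⟨f₁, f₂, f₃⟩ := hF (2 * N)
    obtain ⟨f₁', f₂', f₃'⟩ := hF' (2 * N)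
    exact pairing_sub_le p₁ p₂ p₃ f₁ f₂ f₃ f₁' f₂' f₃' (n₁.trans hn) (n₂.trans hn') c₁ c₂
  have hlim : Tendsto (fun N : ℕ => ((8 : ℝ) / 9) ^ N * (D * 2)) atTop (nhds 0) := by
    simpa using (tendsto_pow_atTop_nhds_zero_of_lt_one (by norm_num : (0 : ℝ) ≤ 8 / 9)
      (by norm_num)).mul_const (D * 2)
  have := ge_of_tendsto' hlim key
  exact sub_eq_zero.1 (abs_nonpos_iff.1 this)

end ArnouxRauzy

/-! ### Unique ergodicity and the numerical profile of a system -/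

namespace ArnouxRauzy

/-- The lengths of the three words of level `m`. -/
noncomputable def len (k n : ℕ → ℕ) (i : Fin 3) (m : ℕ) : ℝ := ((level k n m i).length : ℕ)

theorem lengthRec_len (k n : ℕ → ℕ) :
    LengthRec k (IsMark n) (len k n 0) (len k n 1) (len k n 2) :=
  lengthRec_of_additive k n List.length fun _ _ => List.length_append

theorem len_zero (k n : ℕ → ℕ) (i : Fin 3) : len k n i 0 = 1 := by
  rw [len, level_zero]; simp

/-- A step adds twice k_{m+1} h_m to both sides. -/
theorem length_bispecial (k n : ℕ → ℕ) (m : ℕ) :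
    2 * ((bispecial k n m).length : ℝ) + 3 = len k n 0 m + len k n 1 m + len k n 2 m := by
  induction m with
  | zero => rw [len_zero, len_zero, len_zero]; simp [bispecial]; norm_num
  | succ m ih =>
    have H := lengthRec_len k n
    have e : ((bispecial k n (m + 1)).length : ℝ) =
        (bispecial k n m).length + k (m + 1) * len k n 0 m := by
      rw [bispecial, List.length_append, length_wordPow, len]; push_cast; ring
    obtain ⟨e₁, ⟨e₂, e₃⟩ | ⟨e₂, e₃⟩⟩ := H.step m <;> rw [e, e₁, e₂, e₃] <;> linarith

section

variable {k n : ℕ → ℕ} {μ ν : Measure (ℕ → Letter)}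

theorem IsParameter.sum_towerFr_zero (hp : IsParameter k n)
    (hμ : IsInvariantProbability (language k n) μ) :
    towerFr μ k n 0 0 + towerFr μ k n 0 1 + towerFr μ k n 0 2 = 1 := by
  obtain ⟨x, l, hs⟩ := exists_isStage k n 0
  have := hs.fr_eq_sum (hp.codes 0) hμ
  rw [Fin.sum_univ_three] at this
  rw [show bispecial k n 0 = [] from rfl, hμ.fr_nil] at this
  exact this.symm

theorem IsParameter.pairing_eq_one (hp : IsParameter k n)
    (hμ : IsInvariantProbability (language k n) μ) (m : ℕ) :
    len k n 0 m * towerFr μ k n m 0 + len k n 1 m * towerFr μ k n m 1 +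
      len k n 2 m * towerFr μ k n m 2 = 1 := by
  rw [(lengthRec_len k n).pairing (hp.freqRec hμ) m, len_zero, len_zero, len_zero, one_mul,
    one_mul, one_mul, hp.sum_towerFr_zero hμ]

/-- Counting one letter is additive, and its pairing at level 0 is the frequency of that letter. So
level 0 is determined, and the recursion determines the other levels. -/
theorem IsParameter.towerFr_unique (hp : IsParameter k n)
    (hμ : IsInvariantProbability (language k n) μ)
    (hν : IsInvariantProbability (language k n) ν) (m : ℕ) (i : Fin 3) :
    towerFr μ k n m i = towerFr ν k n m i := by
  have key : ∀ φ : Letter → ℕ, φ 0 * towerFr μ k n 0 0 + φ 1 * towerFr μ k n 0 1 +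
      φ 2 * towerFr μ k n 0 2 = φ 0 * towerFr ν k n 0 0 + φ 1 * towerFr ν k n 0 1 +
      φ 2 * towerFr ν k n 0 2 := by
    intro φ
    have H' := lengthRec_of_additive k n (fun w => (w.map φ).sum) (by simp)
    have := pairing_unique (lengthRec_len k n) H' hp.one_le_k (len_zero k n 0) (len_zero k n 1)
      (len_zero k n 2) (hp.freqRec hμ) (hp.freqRec hν)
      (fun m => ⟨towerFr_nonneg _ _ _ _ _, towerFr_nonneg _ _ _ _ _, towerFr_nonneg _ _ _ _ _⟩)
      (fun m => ⟨towerFr_nonneg _ _ _ _ _, towerFr_nonneg _ _ _ _ _, towerFr_nonneg _ _ _ _ _⟩)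
      (hp.sum_towerFr_zero hμ) (hp.sum_towerFr_zero hν)
    simpa [level_zero] using this
  have h₀ := key ![1, 0, 0]
  have h₁ := key ![0, 1, 0]
  have h₂ := key ![0, 0, 1]
  obtain ⟨e₀, e₁, e₂⟩ := (hp.freqRec hμ).ext (hp.freqRec hν) ⟨by simpa using h₀, by simpa using h₁,
    by simpa using h₂⟩ m
  fin_cases i
  exacts [e₀, e₁, e₂]

theorem IsParameter.invariant_unique (hp : IsParameter k n)
    (hμ : IsInvariantProbability (language k n) μ)
    (hν : IsInvariantProbability (language k n) ν) : ν = μ := by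
  have := hμ.isProbabilityMeasure
  have := hν.isProbabilityMeasure
  refine measure_ext_of_fr fun m => ⟨(bispecial k n m).length + 1,
    (hp.le_length_bispecial m).trans (Nat.le_succ _), fun f => ?_⟩
  obtain ⟨x, l, hs⟩ := exists_isStage k n m
  rw [hs.fr_eq_sum_occ (hp.codes m) hμ (by
      rw [Fin.sum_univ_three]; exact hp.pairing_eq_one hμ m),
    hs.fr_eq_sum_occ (hp.codes m) hν (by
      rw [Fin.sum_univ_three]; exact hp.pairing_eq_one hν m)]
  exact Finset.sum_congr rfl fun i _ => congrArg _ (hp.towerFr_unique hν hμ m i)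

theorem IsParameter.le_n (hp : IsParameter k n) (i : ℕ) (hi : 1 ≤ i) : i ≤ n i := by
  induction i, hi using Nat.le_induction with
  | base => exact hp.one_le_n
  | succ i hi ih => have := hp.n_lt_succ i hi; omega

theorem IsParameter.exists_mark (hp : IsParameter k n) (m : ℕ) : ∃ m', m < m' ∧ IsMark n m' :=
  ⟨n (m + 1), hp.le_n (m + 1) (by omega), m + 1, by omega, rfl⟩

end

/-- Positivity and order of the solutions of the recursion. -/
theorem FreqRec.order {k : ℕ → ℕ} {R : ℕ → Prop} {h g j a b c : ℕ → ℝ} (F : FreqRec k R a b c)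
    (hk : ∀ m, 1 ≤ m → 1 ≤ k m) (hR : ∀ m, ∃ m', m < m' ∧ R m')
    (hF : ∀ m, 0 ≤ a m ∧ 0 ≤ b m ∧ 0 ≤ c m) (hn : ∀ m, h m * a m + g m * b m + j m * c m = 1)
    (m : ℕ) : 0 < c m ∧ c m ≤ b m ∧ b m + c m ≤ a m := by
  have hsum : ∀ m, b m + c m ≤ a m := by
    intro m
    have hk' : (1 : ℝ) ≤ k (m + 1) := by exact_mod_cast hk (m + 1) (by omega)
    obtain ⟨-, f₂, f₃⟩ := hF m
    obtain ⟨-, f₅, f₆⟩ := hF (m + 1)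
    have : b m + c m ≤ k (m + 1) * (b m + c m) := by nlinarith
    by_cases hm : R (m + 1)
    · linarith [(F.one m hm).2]
    · linarith [(F.two m hm).2]
  have hbc : ∀ m, c m ≤ b m := by
    intro m
    have h₁ := hsum (m + 1)
    obtain ⟨-, f₅, f₆⟩ := hF (m + 1)
    rw [F.a_succ] at h₁
    by_cases hm : R (m + 1)
    · linarith [(F.one m hm).1]
    · linarith [(F.two m hm).1]
  have hb : ∀ m, 0 < b m := by
    intro m
    rw [← F.a_succ]
    obtain ⟨f₁, f₂, f₃⟩ := hF (m + 1)
    refine lt_of_le_of_ne f₁ fun h₀ => ?_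
    have h₁ := hsum (m + 1)
    have h₂ : b (m + 1) = 0 := by linarith
    have h₃ : c (m + 1) = 0 := by linarith
    have := hn (m + 1)
    rw [← h₀, h₂, h₃] at this
    norm_num at this
  refine ⟨?_, hbc m, hsum m⟩
  -- Unmarked steps leave c unchanged, and at the next mark c becomes the following b, already known
  -- to be positive.
  obtain ⟨m', hm', hRm'⟩ := hR m
  obtain ⟨d, rfl⟩ : ∃ d, m' = m + 1 + d := ⟨m' - (m + 1), by omega⟩
  clear hm'
  induction d generalizing m with
  | zero => rw [← (F.one m hRm').1]; exact hb _
  | succ d ih =>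
    by_cases hm : R (m + 1)
    · rw [← (F.one m hm).1]; exact hb _
    · rw [← (F.two m hm).1]
      exact ih (m + 1) (by rwa [show m + 1 + 1 + d = m + 1 + (d + 1) by ring])

namespace IsInvariantProbability

variable {L : Set Word} {μ : Measure (ℕ → Letter)}

theorem measure_cylinder (hμ : IsInvariantProbability L μ) (w : Word) :
    μ (cylinder L w) = ENNReal.ofReal (fr μ w) := by
  have := hμ.isProbabilityMeasure
  have e : cylinder L w = symbolicSpace L ∩ {y | win y 0 w.length = w} := by
    ext y; simp [cylinder, win]
  rw [e, Set.inter_comm, measure_inter_conull hμ.carried, fr, Measure.real,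
    ENNReal.ofReal_toReal (measure_ne_top _ _)]

theorem mem_of_fr_pos (hμ : IsInvariantProbability L μ) {w : Word} (h : 0 < fr μ w) : w ∈ L := by
  by_contra hw
  have : μ (cylinder L w) = 0 := by
    have : cylinder L w = ∅ := by
      refine Set.eq_empty_of_forall_notMem fun y hy => hw ?_
      have h₁ := hy.1 0 w.length
      have h₂ := hy.2
      simp only [zero_add] at h₁
      rwa [h₂] at h₁
    rw [this, measure_empty]
  rw [hμ.measure_cylinder, ENNReal.ofReal_eq_zero] at this
  linarith

theorem smallestFrequency_le (hμ : IsInvariantProbability L μ) {w : Word} (h : 0 < fr μ w) :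
    smallestFrequency L μ w.length ≤ ENNReal.ofReal (fr μ w) :=
  sInf_le ⟨ENNReal.ofReal_pos.2 h, w, hμ.mem_of_fr_pos h, rfl, hμ.measure_cylinder w⟩

theorem le_smallestFrequency (hμ : IsInvariantProbability L μ) {N : ℕ} {r : ℝ}
    (h : ∀ w ∈ L, w.length = N → r ≤ fr μ w) : ENNReal.ofReal r ≤ smallestFrequency L μ N := by
  refine le_sInf ?_
  rintro _ ⟨-, w, hw, hN, rfl⟩
  rw [hμ.measure_cylinder]
  exact ENNReal.ofReal_le_ofReal (h w hw hN)

end IsInvariantProbability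

/-- The data of an Arnoux–Rauzy system from which its invariant `𝓑` is computed: the lengths
`h, g, j` of the words of each level, the measures `a, b, c` of the corresponding towers, and
the smallest frequencies `E`. -/
structure Profile (k : ℕ → ℕ) (R : ℕ → Prop) (h g j a b c : ℕ → ℝ) (E : ℕ → ℝ≥0∞) : Prop where
  one_le_k : ∀ m, 1 ≤ m → 1 ≤ k m
  exists_one : ∀ m, ∃ m', m < m' ∧ R m'
  length : LengthRec k R h g j
  h_zero : h 0 = 1
  g_zero : g 0 = 1
  j_zero : j 0 = 1
  lt_h : ∀ m : ℕ, (m : ℝ) < h m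
  freq : FreqRec k R a b c
  order : ∀ m, 0 < c m ∧ c m ≤ b m ∧ b m + c m ≤ a m
  pairing : ∀ m, h m * a m + g m * b m + j m * c m = 1
  upper : ∀ m, ∃ N : ℕ, 2 * (N : ℝ) = h m + g m + j m + 2 * (k (m + 1) - 1) * h m + 1 ∧
    E N ≤ ENNReal.ofReal (c (m + 1))
  upper' : ∀ m, ∃ N : ℕ, 2 * (N : ℝ) = h m + g m + j m - 1 ∧ E N ≤ ENNReal.ofReal (c m)
  lower : ∀ m N : ℕ, 2 * (N : ℝ) ≤ h m + g m + j m - 1 → ENNReal.ofReal (c m) ≤ E N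

theorem IsParameter.profile {k n : ℕ → ℕ} {μ : Measure (ℕ → Letter)} (hp : IsParameter k n)
    (hμ : IsInvariantProbability (language k n) μ) :
    Profile k (IsMark n) (len k n 0) (len k n 1) (len k n 2) (fun m => towerFr μ k n m 0)
      (fun m => towerFr μ k n m 1) (fun m => towerFr μ k n m 2)
      (smallestFrequency (language k n) μ) := by
  have hord := (hp.freqRec hμ).order hp.one_le_k hp.exists_mark
    (fun m => ⟨towerFr_nonneg _ _ _ _ _, towerFr_nonneg _ _ _ _ _, towerFr_nonneg _ _ _ _ _⟩)
    (hp.pairing_eq_one hμ)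
  refine ⟨hp.one_le_k, hp.exists_mark, lengthRec_len k n, len_zero k n 0, len_zero k n 1,
    len_zero k n 2, fun m => ?_, hp.freqRec hμ, hord, hp.pairing_eq_one hμ, fun m => ?_, fun m => ?_,
    fun m N hN => ?_⟩
  · rw [len]
    exact_mod_cast hp.lt_length_level m
  · obtain ⟨t, ht⟩ := hp.exists_k m
    obtain ⟨x, l, hs⟩ := exists_isStage k n m
    have hs' := hs.iterate t
    have hc := hp.codes_iterate m ht.ge
    rw [Function.iterate_succ_apply'] at hc
    -- The rare word is built on the last intermediate bispecial word p H^t with t = k − 1, and ends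
    -- with the first letter of the word that becomes J.
    have e : fr μ (l 0 :: (bispecial k n m ++ wordPow (level k n m 0) t) ++
        [x (levelPerm n m 2)]) = towerFr μ k n (m + 1) 2 := by
      rw [hs'.fr_left_letter hc hμ, towerFr_succ, ht, wordPow_succ, Function.iterate_succ_apply',
        ← List.append_assoc]
      congr 3
      rw [addStep_iterate]; simp
    refine ⟨(l 0 :: (bispecial k n m ++ wordPow (level k n m 0) t) ++ [x (levelPerm n m 2)]).length,
      ?_, ?_⟩
    · have h₁ := length_bispecial k n m
      simp only [List.length_append, List.length_cons, length_wordPow, List.length_nil]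
      rw [ht]
      push_cast
      change 2 * (_ + t * len k n 0 m + 1 + 1) = _
      linarith
    · rw [← e]
      exact hμ.smallestFrequency_le (by rw [e]; exact (hord (m + 1)).1)
  · obtain ⟨x, l, hs⟩ := exists_isStage k n m
    have e := hs.fr_head (hp.codes m) hμ 2
    refine ⟨(bispecial k n m ++ [x 2]).length, ?_, ?_⟩
    · have h₁ := length_bispecial k n m
      simp only [List.length_append, List.length_cons, List.length_nil]
      push_cast
      linarith
    · show _ ≤ ENNReal.ofReal (fr μ _)
      rw [← e]
      exact hμ.smallestFrequency_le (by rw [e]; exact (hord m).1)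
  · refine hμ.le_smallestFrequency fun w hw hlen => ?_
    obtain ⟨x, l, hs⟩ := exists_isStage k n m
    have h₁ := length_bispecial k n m
    obtain ⟨i, hi⟩ := hs.infix_of_mem (hp.codes m) hw (by
      have : (N : ℝ) ≤ (bispecial k n m).length + 1 := by linarith
      rw [hlen]; exact_mod_cast this)
    refine le_trans ?_ (hμ.fr_infix hi)
    obtain ⟨o₁, o₂, o₃⟩ := hord m
    fin_cases i
    · show _ ≤ towerFr μ k n m 0
      linarith
    · exact o₂
    · exact le_rfl

end ArnouxRauzy

/-! ### The gap: a marked step followed by an unmarked one -/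

namespace ArnouxRauzy

/-- In this lemma and the next, the common left side is 2(ha + gb + jc), with a and b expressed by
the measures of later levels. The constraints on lengths and those on measures define two cones, and
products of their nonnegative forms certify the contradiction. -/
theorem gap_two_one_one {h g j c r x : ℝ} (hj : 0 ≤ j) (hgj : j ≤ g) (hhj : j ≤ h)
    (hg : g ≤ h + j) (hr : 0 ≤ r) (hrc : r ≤ c)
    (hx : c + 2 * r ≤ x)
    (I₁ : 2 * (h * (2 * x + 2 * c + r) + g * (x + c + r) + j * c) < 9 * ((h + g - j) * c))
    (I₃ : 2 * (h * (2 * x + 2 * c + r) + g * (x + c + r) + j * c) < 9 * ((3 * h + g + j) * r)) :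
    False := by
  have p₁ := mul_nonneg (sub_nonneg.2 hx) (by linarith : 0 ≤ 2 * h + g)
  have p₂ := mul_nonneg (sub_nonneg.2 hrc) (by linarith : 0 ≤ h + j - g)
  have p₃ := mul_nonneg (sub_nonneg.2 hrc) hj
  have p₄ := mul_nonneg (sub_nonneg.2 hrc) (sub_nonneg.2 hhj)
  have p₅ := mul_nonneg hr (by linarith : 0 ≤ h + j - g)
  have p₆ := mul_nonneg hr hj
  have p₇ := mul_nonneg hr (sub_nonneg.2 hhj)
  have p₈ := mul_nonneg hr (sub_nonneg.2 hgj)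
  linarith

theorem gap_two_one_one_one {h g j c r s : ℝ} (hj : 0 ≤ j) (hgj : j ≤ g) (hhj : j ≤ h)
    (hg : g ≤ h + j) (hh : h ≤ g + j) (hs : 0 ≤ s) (hsr : s ≤ r) (hrc : r + s ≤ c)
    (I₁ : 2 * (h * (4 * c + 3 * r + 2 * s) + g * (2 * c + 2 * r + s) + j * c) <
      9 * ((h + g - j) * c))
    (I₂ : 2 * (h * (4 * c + 3 * r + 2 * s) + g * (2 * c + 2 * r + s) + j * c) <
      9 * ((h + g + j) * c))
    (I₃ : 2 * (h * (4 * c + 3 * r + 2 * s) + g * (2 * c + 2 * r + s) + j * c) <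
      9 * ((3 * h + g + j) * r))
    (I₄ : 2 * (h * (4 * c + 3 * r + 2 * s) + g * (2 * c + 2 * r + s) + j * c) <
      9 * ((5 * h + 3 * g + j) * s)) :
    False := by
  have q₁ : 0 ≤ h - j := by linarith
  have q₂ : 0 ≤ g - j := by linarith
  have q₃ : 0 ≤ h + j - g := by linarith
  have q₄ : 0 ≤ g + j - h := by linarith
  have r₁ : 0 ≤ r - s := by linarith
  have r₂ : 0 ≤ c - r - s := by linarith
  have p₁ := mul_nonneg hs hj
  have p₂ := mul_nonneg hs q₁
  have p₃ := mul_nonneg hs q₂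
  have p₄ := mul_nonneg hs q₃
  have p₅ := mul_nonneg hs q₄
  have p₆ := mul_nonneg r₁ hj
  have p₇ := mul_nonneg r₁ q₁
  have p₈ := mul_nonneg r₁ q₂
  have p₉ := mul_nonneg r₁ q₃
  have t₁ := mul_nonneg r₁ q₄
  have t₂ := mul_nonneg r₂ hj
  have t₃ := mul_nonneg r₂ q₁
  have t₄ := mul_nonneg r₂ q₂
  have t₅ := mul_nonneg r₂ q₃
  have t₆ := mul_nonneg r₂ q₄
  linarith

theorem gap_simple {h g j a b c : ℝ} (hh : 0 ≤ h) (hg0 : 0 ≤ g) (hj : 0 ≤ j)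
    (hg : g ≤ h + j) (hc : 0 ≤ c) (hab : 6 * c ≤ a ∧ 3 * c ≤ b ∨ 7 * c ≤ a ∧ 2 * c ≤ b)
    (I₁ : 2 * (h * a + g * b + j * c) < 9 * ((h + g - j) * c)) : False := by
  have p := mul_nonneg hc (by linarith : 0 ≤ h + j - g)
  have p' := mul_nonneg hc hj
  rcases hab with ⟨ha, hb⟩ | ⟨ha, hb⟩
  · have p₁ := mul_le_mul_of_nonneg_left ha hh
    have p₂ := mul_le_mul_of_nonneg_left hb hg0
    nlinarith
  · have p₁ := mul_le_mul_of_nonneg_left ha hh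
    have p₂ := mul_le_mul_of_nonneg_left hb hg0
    nlinarith

theorem gap_k_two_one {h g j c r s : ℝ} (hgj : j ≤ g) (hgh : g ≤ h) (hh : h ≤ 2 * j)
    (hs : 0 ≤ s) (hsr : s ≤ r) (hrc : r + s ≤ c)
    (I₁ : 2 * (h * (4 * c + 3 * r + 2 * s) + g * (c + r + s) + j * c) <
      9 * ((h + g - j) * c))
    (I₂ : 2 * (h * (4 * c + 3 * r + 2 * s) + g * (c + r + s) + j * c) <
      9 * ((3 * h + g + j) * r)) :
    False := by
  have q₁ : 0 ≤ g - j := by linarith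
  have q₂ : 0 ≤ h - g := by linarith
  have q₃ : 0 ≤ 2 * j - h := by linarith
  have r₁ : 0 ≤ r - s := by linarith
  have r₂ : 0 ≤ c - r - s := by linarith
  have p₁ := mul_nonneg hs q₁
  have p₂ := mul_nonneg hs q₂
  have p₃ := mul_nonneg hs q₃
  have p₄ := mul_nonneg r₁ q₁
  have p₅ := mul_nonneg r₁ q₂
  have p₆ := mul_nonneg r₁ q₃
  have p₇ := mul_nonneg r₂ q₁
  have p₈ := mul_nonneg r₂ q₂
  have p₉ := mul_nonneg r₂ q₃
  linarith

/-- `I₁` forces 7r < c, while `I₂` forces 2kc < 3(2k + 1)r; these are incompatible. -/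
theorem gap_k_two_two {h g j a b c r k : ℝ} (hh : 0 < h) (hj : 0 ≤ j) (hgj : j ≤ g) (hgh : g ≤ h)
    (hk : 2 ≤ k) (hr : 0 < r) (hc : 0 < c)
    (hb : 2 * c + 2 * r ≤ b) (ha : a = k * (b + c) + r)
    (I₁ : 2 * (h * a + g * b + j * c) < 9 * ((h + g - j) * c))
    (I₂ : 2 * (h * a + g * b + j * c) < 9 * ((g + j + (2 * k - 1) * h) * r)) : False := by
  have a₁ : k * (3 * c) ≤ a := by
    have : k * (3 * c) ≤ k * (b + c) := mul_le_mul_of_nonneg_left (by linarith) (by linarith)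
    linarith
  have a₂ : 6 * c + 5 * r ≤ a := by
    have : 2 * (b + c) ≤ k * (b + c) := mul_le_mul_of_nonneg_right hk (by linarith)
    linarith
  have e₁ := mul_le_mul_of_nonneg_left a₂ hh.le
  have e₂ := mul_le_mul_of_nonneg_left hb (hj.trans hgj)
  have e₃ := mul_le_mul_of_nonneg_left a₁ hh.le
  have e₄ : 0 ≤ (h - g) * c := mul_nonneg (by linarith) hc.le
  have e₅ : 0 ≤ (h - g) * r := mul_nonneg (by linarith) hr.le
  have e₆ : 0 ≤ j * c := mul_nonneg hj hc.le
  have f₁ : g * (7 * r) < g * c := by nlinarith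
  have f₂ : 7 * r < c := lt_of_mul_lt_mul_left f₁ (hj.trans hgj)
  have f₃ : 0 ≤ g * b := mul_nonneg (hj.trans hgj) (by linarith)
  have f₄ : (g + j + (2 * k - 1) * h) * r ≤ ((2 * k + 1) * h) * r :=
    mul_le_mul_of_nonneg_right (by nlinarith) hr.le
  have f₅ : h * (6 * k * c) < h * (9 * (2 * k + 1) * r) := by nlinarith
  have f₆ := lt_of_mul_lt_mul_left f₅ hh.le
  nlinarith

namespace Profile

variable {k : ℕ → ℕ} {R : ℕ → Prop} {h g j a b c : ℕ → ℝ} {E : ℕ → ℝ≥0∞}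

theorem one_le_k' (P : Profile k R h g j a b c E) (m : ℕ) : (1 : ℝ) ≤ k (m + 1) := by
  exact_mod_cast P.one_le_k (m + 1) (by omega)

theorem bounds (P : Profile k R h g j a b c E) (m : ℕ) :
    0 < h m ∧ 0 < g m ∧ 0 < j m ∧ j m ≤ h m + g m ∧ g m ≤ h m + j m ∧
      (g m ≤ h m ∨ j m ≤ h m) :=
  P.length.bounds P.one_le_k P.h_zero P.g_zero P.j_zero m

theorem k_eq_one (P : Profile k R h g j a b c E) {m : ℕ} (hk : ¬ 2 ≤ k (m + 1)) :
    (k (m + 1) : ℝ) = 1 := by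
  have := P.one_le_k (m + 1) (by omega)
  exact_mod_cast (by omega : k (m + 1) = 1)

/-- A step of the second kind that follows a step of the first kind. -/
theorem gap_of_mark (P : Profile k R h g j a b c E) {m : ℕ} (h₁ : R (m + 1)) (h₂ : ¬ R (m + 2)) :
    ∃ i ≥ m, 9 * ((h i + g i + j i + 2 * (k (i + 1) - 1) * h i) * c (i + 1)) ≤ 2 := by
  -- If all the products exceed 2/9, then `gap_simple` bounds a/c and b/c at level m + 1. This
  -- forces k_{m+2} = 1, then a mark at m + 3 with k_{m+3} = 1, so that few parameters remain.
  by_contra! hcon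
  obtain ⟨u₁, u₂, u₃, u₄, u₅, -⟩ := P.bounds m
  obtain ⟨v₁, v₂, v₃, v₄, v₅, -⟩ := P.bounds (m + 1)
  have k₀ := P.one_le_k' m
  have k₁ := P.one_le_k' (m + 1)
  have k₂ := P.one_le_k' (m + 2)
  have lh := P.length.h_succ m
  obtain ⟨lg, lj⟩ := P.length.one m h₁
  have hkh : h m ≤ k (m + 1) * h m := le_mul_of_one_le_left u₁.le k₀
  have F := P.pairing (m + 1)
  have I₁ := hcon m le_rfl
  have I₂ := hcon (m + 1) (by omega)
  have I₃ := hcon (m + 2) (by omega)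
  have I₄ := hcon (m + 3) (by omega)
  have lh' := P.length.h_succ (m + 1)
  obtain ⟨lg', lj'⟩ := P.length.two (m + 1) h₂
  have lh'' := P.length.h_succ (m + 2)
  obtain ⟨fc, fa⟩ := P.freq.two (m + 1) h₂
  have fa' := P.freq.a_succ (m + 1)
  have fa'' := P.freq.a_succ (m + 2)
  obtain ⟨o₁, o₂, o₃⟩ := P.order (m + 1)
  obtain ⟨o₁', o₂', o₃'⟩ := P.order (m + 2)
  obtain ⟨o₁'', o₂'', o₃''⟩ := P.order (m + 3)
  simp only [add_assoc, Nat.reduceAdd] at *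
  -- After a marked step, the length attached to level m is h + g − j in the lengths of level m + 1,
  -- where the comparison takes place.
  have d₁ : h m + (g m + (j m + 2 * (k (m + 1) - 1) * h m)) =
      h (m + 1) + g (m + 1) - j (m + 1) := by
    rw [lh, lg, lj]; ring
  rw [d₁] at I₁
  have hab : ¬ (6 * c (m + 1) ≤ a (m + 1) ∧ 3 * c (m + 1) ≤ b (m + 1) ∨
      7 * c (m + 1) ≤ a (m + 1) ∧ 2 * c (m + 1) ≤ b (m + 1)) := fun hab =>
    gap_simple v₁.le v₂.le v₃.le v₅ o₁.le hab (by linarith)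
  push Not at hab
  have hbb : b (m + 1) + c (m + 1) ≤ k (m + 2) * (b (m + 1) + c (m + 1)) :=
    le_mul_of_one_le_left (by linarith) k₁
  have hk₁ : ¬ 2 ≤ k (m + 2) := by
    intro hk
    have hk' : (2 : ℝ) ≤ k (m + 2) := by exact_mod_cast hk
    have : 2 * (b (m + 1) + c (m + 1)) ≤ k (m + 2) * (b (m + 1) + c (m + 1)) :=
      mul_le_mul_of_nonneg_right hk' (by linarith)
    have := hab.2 (by linarith)
    linarith
  have k₁' := P.k_eq_one (m := m + 1) hk₁
  simp only [add_assoc, Nat.reduceAdd] at k₁'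
  rw [k₁', one_mul] at fa lh' lj'
  have hb' : b (m + 2) < 2 * c (m + 1) := by
    by_contra! hb'
    have := hab.1 (by linarith)
    linarith
  by_cases h₃ : R (m + 3)
  swap
  · obtain ⟨e₁, e₂⟩ := P.freq.two (m + 2) h₃
    simp only [add_assoc, Nat.reduceAdd] at e₁ e₂
    linarith
  obtain ⟨e₁, e₂⟩ := P.freq.one (m + 2) h₃
  obtain ⟨lg'', lj''⟩ := P.length.one (m + 2) h₃
  simp only [add_assoc, Nat.reduceAdd] at e₁ e₂ lg'' lj''
  have hk₂ : ¬ 2 ≤ k (m + 3) := by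
    intro hk
    have hk' : (2 : ℝ) ≤ k (m + 3) := by exact_mod_cast hk
    have : 2 * (b (m + 2) + c (m + 2)) ≤ k (m + 3) * (b (m + 2) + c (m + 2)) :=
      mul_le_mul_of_nonneg_right hk' (by linarith)
    have := hab.1 (by linarith)
    linarith
  have k₂' := P.k_eq_one (m := m + 2) hk₂
  simp only [add_assoc, Nat.reduceAdd] at k₂'
  rw [k₂', one_mul] at e₂ lh'' lg''
  rw [k₁', fc] at I₂
  rw [k₂', lg'] at I₃
  set H := h (m + 1)
  set G := g (m + 1)
  set J := j (m + 1)
  set C := c (m + 1)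
  set r := c (m + 3)
  set x := b (m + 2)
  have eb : b (m + 1) = x + C + r := by linarith
  have ea : a (m + 1) = 2 * x + 2 * C + r := by linarith
  rw [ea, eb] at F
  have hC : r ≤ C := by linarith
  have hJG : J ≤ G := by linarith
  have hJH : J ≤ H := by linarith
  have hHG : H ≤ G + J := by linarith
  have I₃' : 2 < 9 * ((3 * H + G + J) * r) := by
    have : h (m + 2) + (H + (j (m + 2) + 2 * (1 - 1) * h (m + 2))) = 3 * H + G + J := by
      rw [lh', lj']; ring
    rwa [this] at I₃
  have I₂' : 2 < 9 * ((H + G + J) * C) := by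
    have : H + (G + (J + 2 * (1 - 1) * H)) = H + G + J := by ring
    rwa [this] at I₂
  -- Otherwise the step m + 4 must be marked with multiplicity 1, since any other step makes x at
  -- least C + 2r; then x = C + r + s.
  by_cases hx : C + 2 * r ≤ x
  · exact gap_two_one_one v₃.le hJG hJH v₅ o₁''.le hC hx (by linarith) (by linarith)
  obtain ⟨o₁''', o₂''', o₃'''⟩ := P.order (m + 4)
  have fa''' := P.freq.a_succ (m + 3)
  have k₃ := P.one_le_k' (m + 3)
  simp only [add_assoc, Nat.reduceAdd] at fa''' k₃
  have hbb' : b (m + 3) + r ≤ k (m + 4) * (b (m + 3) + r) :=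
    le_mul_of_one_le_left (by linarith) k₃
  by_cases h₄ : R (m + 4)
  swap
  · obtain ⟨w₁, w₂⟩ := P.freq.two (m + 3) h₄
    simp only [add_assoc, Nat.reduceAdd] at w₁ w₂
    exact hx (by linarith)
  obtain ⟨w₁, w₂⟩ := P.freq.one (m + 3) h₄
  simp only [add_assoc, Nat.reduceAdd] at w₁ w₂
  have hk₃ : ¬ 2 ≤ k (m + 4) := by
    intro hk
    have hk' : (2 : ℝ) ≤ k (m + 4) := by exact_mod_cast hk
    have : 2 * (b (m + 3) + r) ≤ k (m + 4) * (b (m + 3) + r) :=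
      mul_le_mul_of_nonneg_right hk' (by linarith)
    exact hx (by linarith)
  have k₃' := P.k_eq_one (m := m + 3) hk₃
  simp only [add_assoc, Nat.reduceAdd] at k₃'
  rw [k₃', one_mul] at w₂
  rw [k₃'] at I₄
  have I₄' : 2 < 9 * ((5 * H + 3 * G + J) * c (m + 4)) := by
    have : h (m + 3) + (g (m + 3) + (j (m + 3) + 2 * (1 - 1) * h (m + 3))) =
        5 * H + 3 * G + J := by
      rw [lh'', lg'', lj'', lh', lj', lg']; ring
    rwa [this] at I₄
  set s := c (m + 4)
  have ex : x = C + r + s := by linarith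
  rw [ex] at F
  have F' : H * (4 * C + 3 * r + 2 * s) + G * (2 * C + 2 * r + s) + J * C = 1 := by
    rw [← F]; ring
  exact gap_two_one_one_one (c := C) (r := r) v₃.le hJG hJH v₅ hHG o₁'''.le (by linarith)
    (by linarith) (by linarith) (by linarith) (by linarith) (by linarith)

end Profile

end ArnouxRauzy

/-! ### The gap: multiplicities at least two, and the general case -/

namespace ArnouxRauzy

theorem gap_k_three {h g j a b c k : ℝ} (hgj : j ≤ g) (hgh : g ≤ h) (hh : h ≤ 2 * j)
    (hk : 3 ≤ k) (hc : 0 < c) (hb : c ≤ b) (ha : k * (b + c) ≤ a)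
    (I₁ : 2 * (h * a + g * b + j * c) < 9 * ((h + g - j) * c)) : False := by
  have a₁ : 6 * c ≤ a := by
    have : 3 * (b + c) ≤ k * (b + c) := mul_le_mul_of_nonneg_right hk (by linarith)
    linarith
  have e₁ := mul_le_mul_of_nonneg_left a₁ (by linarith : 0 ≤ h)
  have e₂ := mul_le_mul_of_nonneg_left hb (by linarith : 0 ≤ g)
  have e₃ : 0 ≤ (h - g) * c := mul_nonneg (by linarith) hc.le
  have e₄ : 0 ≤ (2 * j - h) * c := mul_nonneg (by linarith) hc.le
  have e₅ : 0 ≤ h * c := mul_nonneg (by linarith) hc.le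
  linarith

namespace Profile

variable {k : ℕ → ℕ} {R : ℕ → Prop} {h g j a b c : ℕ → ℝ} {E : ℕ → ℝ≥0∞}

/-- Two consecutive multiplicities at least two, when all steps are of the first kind. -/
theorem gap_of_two_large (P : Profile k R h g j a b c E) {m : ℕ} (h₁ : R (m + 1)) (h₂ : R (m + 2))
    (h₃ : R (m + 3)) (hgh : g (m + 1) ≤ h (m + 1)) (hk₁ : 2 ≤ k (m + 2)) (hk₂ : 2 ≤ k (m + 3)) :
    ∃ i ≥ m, 9 * ((h i + g i + j i + 2 * (k (i + 1) - 1) * h i) * c (i + 1)) ≤ 2 := by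
  by_contra! hcon
  have u₁ := (P.bounds m).1
  have u₃ := (P.bounds m).2.2.1
  obtain ⟨v₁, v₂, v₃, -⟩ := P.bounds (m + 1)
  have k₀ := P.one_le_k' m
  have lh := P.length.h_succ m
  obtain ⟨lg, lj⟩ := P.length.one m h₁
  have hkh : h m ≤ k (m + 1) * h m := le_mul_of_one_le_left u₁.le k₀
  have F := P.pairing (m + 1)
  have I₁ := hcon m le_rfl
  have I₂ := hcon (m + 1) (by omega)
  obtain ⟨f₁, f₂⟩ := P.freq.one (m + 1) h₂
  obtain ⟨f₃, f₄⟩ := P.freq.one (m + 2) h₃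
  have f₅ := P.freq.a_succ (m + 1)
  have o₁ := (P.order (m + 1)).1
  have o₂ := (P.order (m + 2)).1
  have o₃ := (P.order (m + 3)).1
  have hk₁' : (2 : ℝ) ≤ k (m + 2) := by exact_mod_cast hk₁
  have hk₂' : (2 : ℝ) ≤ k (m + 3) := by exact_mod_cast hk₂
  simp only [add_assoc, Nat.reduceAdd] at f₁ f₂ f₃ f₄ f₅ I₁ I₂ F
  have hb : 2 * (b (m + 2) + c (m + 2)) ≤ k (m + 3) * (b (m + 2) + c (m + 2)) :=
    mul_le_mul_of_nonneg_right hk₂' (by linarith)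
  have d₁ : h m + (g m + (j m + 2 * (k (m + 1) - 1) * h m)) =
      h (m + 1) + g (m + 1) - j (m + 1) := by
    rw [lh, lg, lj]; ring
  rw [d₁] at I₁
  refine gap_k_two_two (r := c (m + 2)) v₁ v₃.le (by rw [lg, lj]; linarith) hgh hk₁' o₂ o₁
    (by rw [f₁] at hb f₄; linarith) f₂ (by linarith) ?_
  have d₂ : h (m + 1) + (g (m + 1) + (j (m + 1) + 2 * (k (m + 2) - 1) * h (m + 1))) =
      g (m + 1) + j (m + 1) + (2 * k (m + 2) - 1) * h (m + 1) := by ring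
  rw [d₂] at I₂
  linarith

/-- A multiplicity at least two, when all steps are of the first kind. -/
theorem gap_of_large (P : Profile k R h g j a b c E) {m : ℕ} (hR : ∀ i ≥ m, R (i + 1))
    (hk : 2 ≤ k (m + 4)) :
    ∃ i ≥ m, 9 * ((h i + g i + j i + 2 * (k (i + 1) - 1) * h i) * c (i + 1)) ≤ 2 := by
  have hjg : ∀ i ≥ m, j (i + 1) ≤ g (i + 1) := by
    intro i hi
    obtain ⟨lg, lj⟩ := P.length.one i (hR i hi)
    have u₁ := (P.bounds i).1
    have u₃ := (P.bounds i).2.2.1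
    have hkh : h i ≤ k (i + 1) * h i := le_mul_of_one_le_left u₁.le (P.one_le_k' i)
    rw [lg, lj]
    linarith
  have hgh : ∀ i ≥ m + 1, g (i + 1) ≤ h (i + 1) := by
    intro i hi
    obtain ⟨i, rfl⟩ : ∃ i', i = i' + 1 := ⟨i - 1, by omega⟩
    rw [P.length.h_succ, (P.length.one (i + 1) (hR _ (by omega))).1]
    linarith [hjg i (by omega)]
  by_cases hk₀ : 2 ≤ k (m + 3)
  · obtain ⟨i, hi, h'⟩ := P.gap_of_two_large (m := m + 1) (hR _ (by omega)) (hR _ (by omega))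
      (hR _ (by omega)) (hgh _ (by omega)) hk₀ hk
    exact ⟨i, by omega, h'⟩
  by_cases hk₂ : 2 ≤ k (m + 5)
  · obtain ⟨i, hi, h'⟩ := P.gap_of_two_large (m := m + 2) (hR _ (by omega)) (hR _ (by omega))
      (hR _ (by omega)) (hgh _ (by omega)) hk hk₂
    exact ⟨i, by omega, h'⟩
  -- The large multiplicity is now isolated between two equal to 1; the preceding one gives h ≤ 2j
  -- at level m + 3.
  by_contra! hcon
  have k₀ := P.k_eq_one (m := m + 2) hk₀
  have k₂ := P.k_eq_one (m := m + 4) hk₂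
  have lh := P.length.h_succ (m + 2)
  obtain ⟨lg, lj⟩ := P.length.one (m + 2) (hR _ (by omega))
  have b₁ := hjg (m + 2) (by omega)
  have b₂ := hgh (m + 2) (by omega)
  have b₃ := hgh (m + 1) (by omega)
  have F := P.pairing (m + 3)
  have I₁ := hcon (m + 2) (by omega)
  have I₂ := hcon (m + 3) (by omega)
  obtain ⟨f₁, f₂⟩ := P.freq.one (m + 3) (hR _ (by omega))
  obtain ⟨f₃, f₄⟩ := P.freq.one (m + 4) (hR _ (by omega))
  have f₅ := P.freq.a_succ (m + 3)
  obtain ⟨o₁, o₁', -⟩ := P.order (m + 3)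
  have o₂ := (P.order (m + 4)).1
  obtain ⟨o₃, o₃', o₃''⟩ := P.order (m + 5)
  have f₆ := P.freq.a_succ (m + 4)
  simp only [add_assoc, Nat.reduceAdd] at *
  rw [k₀, one_mul] at lh lg
  have d₁ : h (m + 2) + (g (m + 2) + (j (m + 2) + 2 * (k (m + 3) - 1) * h (m + 2))) =
      h (m + 3) + g (m + 3) - j (m + 3) := by
    rw [lh, lg, lj, k₀]; ring
  rw [d₁] at I₁
  have hhj : h (m + 3) ≤ 2 * j (m + 3) := by rw [lh, lj]; linarith
  by_cases hk₁ : 3 ≤ k (m + 4)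
  · have hk₁' : (3 : ℝ) ≤ k (m + 4) := by exact_mod_cast hk₁
    exact gap_k_three (a := a (m + 3)) b₁ b₂ hhj hk₁' o₁ o₁' (by linarith) (by linarith)
  have k₁ : (k (m + 4) : ℝ) = 2 := by exact_mod_cast (by omega : k (m + 4) = 2)
  rw [k₁] at f₂ I₂
  rw [k₂, one_mul] at f₄
  set C := c (m + 3)
  set r := c (m + 4)
  set s := c (m + 5)
  have eb : b (m + 3) = C + r + s := by linarith
  have ea : a (m + 3) = 4 * C + 3 * r + 2 * s := by linarith
  rw [ea, eb] at F
  refine gap_k_two_one (c := C) (r := r) (s := s) b₁ b₂ hhj o₃.le (by linarith) (by linarith)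
    (by linarith) ?_
  have d₂ : h (m + 3) + (g (m + 3) + (j (m + 3) + 2 * (2 - 1) * h (m + 3))) =
      3 * h (m + 3) + g (m + 3) + j (m + 3) := by ring
  rw [d₂] at I₂
  linarith

/-- Unless all steps are eventually Tribonacci steps, there are infinitely many small
frequencies. -/
theorem gap (P : Profile k R h g j a b c E) (hT : ¬ ∃ M, ∀ m ≥ M, R (m + 1) ∧ k (m + 1) = 1)
    (M : ℕ) : ∃ i ≥ M, 9 * ((h i + g i + j i + 2 * (k (i + 1) - 1) * h i) * c (i + 1)) ≤ 2 := by
  by_cases hR : ∃ M', ∀ i ≥ M', R (i + 1)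
  · obtain ⟨M', hM'⟩ := hR
    push Not at hT
    obtain ⟨m, hm, hkm⟩ := hT (max M M' + 3)
    have hk := hkm (hM' m (by omega))
    have hk' := P.one_le_k (m + 1) (by omega)
    obtain ⟨m, rfl⟩ : ∃ m', m = m' + 3 := ⟨m - 3, by omega⟩
    obtain ⟨i, hi, h'⟩ := P.gap_of_large (m := m) (fun i hi => hM' i (by omega)) (by
      rw [show m + 4 = m + 3 + 1 by ring]; omega)
    exact ⟨i, by omega, h'⟩
  · push Not at hR
    obtain ⟨m₀, hm₀, hRm₀⟩ := P.exists_one (M + 1)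
    classical
    -- The first unmarked step after the mark m₀ comes right after a marked one, as `gap_of_mark`
    -- requires.
    have hex : ∃ d, ¬ R (m₀ + d) := by
      obtain ⟨i, hi, h'⟩ := hR m₀
      exact ⟨i + 1 - m₀, by rwa [show m₀ + (i + 1 - m₀) = i + 1 by omega]⟩
    have hd := Nat.find_spec hex
    have hd₀ : Nat.find hex ≠ 0 := fun h₀ => hd (by rw [h₀]; exact hRm₀)
    obtain ⟨d, hd'⟩ := Nat.exists_eq_succ_of_ne_zero hd₀
    have hmin := Nat.find_min hex (m := d) (by omega)
    push Not at hmin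
    rw [hd'] at hd
    obtain ⟨m, hm⟩ : ∃ m, m₀ + d = m + 1 := ⟨m₀ + d - 1, by omega⟩
    rw [hm] at hmin
    rw [Nat.succ_eq_add_one, ← add_assoc, hm] at hd
    obtain ⟨i, hi, h'⟩ := P.gap_of_mark hmin hd
    exact ⟨i, by omega, h'⟩

end Profile

end ArnouxRauzy

/-! ### Bounds for the limsup and the infinite value -/

namespace ArnouxRauzy

theorem le_limsup_inv {E : ℕ → ℝ≥0∞} {T : ℝ} (hT : 0 < T)
    (H : ∀ M : ℕ, ∃ N ≥ M, ∃ e : ℝ, E N ≤ ENNReal.ofReal e ∧ T * (N * e) ≤ 1) :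
    ENNReal.ofReal T ≤ limsup (fun N : ℕ => ((N : ℝ≥0∞) * E N)⁻¹) atTop := by
  refine le_limsup_of_frequently_le (frequently_atTop.2 fun M => ?_)
  obtain ⟨N, hN, e, he, h⟩ := H M
  refine ⟨N, hN, ?_⟩
  rw [ENNReal.le_inv_iff_le_inv, ← ENNReal.ofReal_inv_of_pos hT]
  calc (N : ℝ≥0∞) * E N ≤ ENNReal.ofReal N * ENNReal.ofReal e := by
        rw [ENNReal.ofReal_natCast]; gcongr
    _ = ENNReal.ofReal (N * e) := (ENNReal.ofReal_mul (Nat.cast_nonneg N)).symm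
    _ ≤ ENNReal.ofReal T⁻¹ := by
        refine ENNReal.ofReal_le_ofReal ?_
        rw [← one_div, le_div_iff₀ hT]; linarith

theorem limsup_inv_le {E : ℕ → ℝ≥0∞} {T : ℝ} (hT : 0 < T) (M : ℕ)
    (H : ∀ N ≥ M, ∃ e : ℝ, ENNReal.ofReal e ≤ E N ∧ 1 ≤ T * (N * e)) :
    limsup (fun N : ℕ => ((N : ℝ≥0∞) * E N)⁻¹) atTop ≤ ENNReal.ofReal T := by
  refine limsup_le_of_le (by isBoundedDefault) (eventually_atTop.2 ⟨M, fun N hN => ?_⟩)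
  obtain ⟨e, he, h⟩ := H N hN
  rw [ENNReal.inv_le_iff_inv_le, ← ENNReal.ofReal_inv_of_pos hT]
  calc ENNReal.ofReal T⁻¹ ≤ ENNReal.ofReal (N * e) := by
        refine ENNReal.ofReal_le_ofReal ?_
        rw [← one_div, div_le_iff₀ hT]; linarith
    _ = ENNReal.ofReal N * ENNReal.ofReal e := ENNReal.ofReal_mul (Nat.cast_nonneg N)
    _ ≤ (N : ℝ≥0∞) * E N := by
        rw [ENNReal.ofReal_natCast]; gcongr

namespace Profile

variable {k : ℕ → ℕ} {R : ℕ → Prop} {h g j a b c : ℕ → ℝ} {E : ℕ → ℝ≥0∞}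

theorem le_limsup (P : Profile k R h g j a b c E) {T : ℝ} (hT : 0 < T)
    (H : ∀ M : ℕ, ∃ m ≥ M,
      T * ((h m + g m + j m + 2 * (k (m + 1) - 1) * h m + 1) * c (m + 1)) ≤ 2) :
    ENNReal.ofReal T ≤ limsup (fun N : ℕ => ((N : ℝ≥0∞) * E N)⁻¹) atTop := by
  refine le_limsup_inv hT fun M => ?_
  obtain ⟨m, hm, h'⟩ := H (2 * M)
  obtain ⟨N, hN, hE⟩ := P.upper m
  obtain ⟨u₁, u₂, u₃, -⟩ := P.bounds m
  have hk := P.one_le_k' m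
  have hlt := P.lt_h m
  have : 0 ≤ (k (m + 1) - 1) * h m := mul_nonneg (by linarith) u₁.le
  have hm' : (2 * M : ℝ) ≤ m := by exact_mod_cast hm
  refine ⟨N, by exact_mod_cast (by linarith : (M : ℝ) ≤ N), _, hE, ?_⟩
  rw [← hN] at h'
  linarith

theorem le_limsup' (P : Profile k R h g j a b c E) {T : ℝ} (hT : 0 < T)
    (H : ∀ M : ℕ, ∃ m ≥ M, T * ((h m + g m + j m) * c m) ≤ 2) :
    ENNReal.ofReal T ≤ limsup (fun N : ℕ => ((N : ℝ≥0∞) * E N)⁻¹) atTop := by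
  refine le_limsup_inv hT fun M => ?_
  obtain ⟨m, hm, h'⟩ := H (2 * M + 1)
  obtain ⟨N, hN, hE⟩ := P.upper' m
  obtain ⟨u₁, u₂, u₃, -⟩ := P.bounds m
  have hlt := P.lt_h m
  have hm' : (2 * M + 1 : ℝ) ≤ m := by exact_mod_cast hm
  refine ⟨N, by exact_mod_cast (by linarith : (M : ℝ) ≤ N), _, hE, ?_⟩
  have hc := (P.order m).1
  rw [show h m + g m + j m = 2 * N + 1 by linarith] at h'
  have := mul_pos hT hc
  linarith

theorem exists_level (P : Profile k R h g j a b c E) (M : ℕ) : ∃ N₀ : ℕ, ∀ N ≥ N₀, ∃ m ≥ M,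
    h m + g m + j m - 1 < 2 * (N : ℝ) ∧
      2 * (N : ℝ) ≤ h (m + 1) + g (m + 1) + j (m + 1) - 1 := by
  obtain ⟨N₀, hN₀⟩ := exists_nat_gt (h M + g M + j M)
  refine ⟨N₀, fun N hN => ?_⟩
  have hN' : (N₀ : ℝ) ≤ N := by exact_mod_cast hN
  have hN₀' : (0 : ℝ) ≤ N := Nat.cast_nonneg N
  classical
  have hex : ∃ d, 2 * (N : ℝ) ≤ h (M + d) + g (M + d) + j (M + d) - 1 := by
    refine ⟨2 * N + 1, ?_⟩
    obtain ⟨u₁, u₂, u₃, -⟩ := P.bounds (M + (2 * N + 1))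
    have := P.lt_h (M + (2 * N + 1))
    push_cast at this
    have hM : (0 : ℝ) ≤ M := Nat.cast_nonneg M
    linarith
  have hd := Nat.find_spec hex
  have hd₀ : Nat.find hex ≠ 0 := fun h₀ => by
    rw [h₀, add_zero] at hd
    linarith
  obtain ⟨d, hd'⟩ := Nat.exists_eq_succ_of_ne_zero hd₀
  have hmin := Nat.find_min hex (m := d) (by omega)
  push Not at hmin
  rw [hd'] at hd
  exact ⟨M + d, by omega, hmin, hd⟩

/-- An integer N > |p_m| + 1 has 2N ≥ h + g + j + 1. This is the length used in `le_limsup` when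
k_{m+1} = 1, so the two bounds match exactly for Tribonacci steps. -/
theorem limsup_le (P : Profile k R h g j a b c E) {T : ℝ} (hT : 0 < T) (M : ℕ)
    (H : ∀ m ≥ M, 2 ≤ T * ((h m + g m + j m + 1) * c (m + 1))) :
    limsup (fun N : ℕ => ((N : ℝ≥0∞) * E N)⁻¹) atTop ≤ ENNReal.ofReal T := by
  obtain ⟨N₀, hN₀⟩ := P.exists_level M
  refine limsup_inv_le hT N₀ fun N hN => ?_
  obtain ⟨m, hm, h₁, h₂⟩ := hN₀ N hN
  refine ⟨_, P.lower (m + 1) N h₂, ?_⟩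
  obtain ⟨N', hN', -⟩ := P.upper' m
  rw [← hN'] at h₁
  have : N' + 1 ≤ N := by
    have : (N' : ℝ) < N := by linarith
    exact_mod_cast this
  have : (N' + 1 : ℝ) ≤ N := by exact_mod_cast this
  have h₃ := H m hm
  rw [show h m + g m + j m + 1 = 2 * (N' + 1) by linarith] at h₃
  have : T * ((N' + 1) * c (m + 1)) ≤ T * (N * c (m + 1)) := by
    have := (P.order (m + 1)).1
    gcongr
  linarith

/-- Systems that are not eventually Tribonacci have a large limit superior. -/
theorem le_limsup_of_gap (P : Profile k R h g j a b c E)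
    (hT : ¬ ∃ M, ∀ m ≥ M, R (m + 1) ∧ k (m + 1) = 1) :
    ENNReal.ofReal (181 / 21) ≤ limsup (fun N : ℕ => ((N : ℝ≥0∞) * E N)⁻¹) atTop := by
  refine P.le_limsup (by norm_num) fun M => ?_
  -- The inequality (181/21)(X + 1) ≤ 9X holds for X ≥ 181/8, so levels from 23 on absorb the
  -- additional 1.
  obtain ⟨m, hm, h'⟩ := P.gap hT (M + 23)
  refine ⟨m, by omega, ?_⟩
  obtain ⟨u₁, u₂, u₃, -⟩ := P.bounds m
  have hk := P.one_le_k' m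
  have hlt := P.lt_h m
  have h₁ : 0 ≤ (k (m + 1) - 1) * h m := mul_nonneg (by linarith) u₁.le
  have hm' : (23 : ℝ) ≤ m := by exact_mod_cast (by omega : 23 ≤ m)
  have hc := (P.order (m + 1)).1
  have : 181 / 21 * (h m + g m + j m + 2 * (k (m + 1) - 1) * h m + 1) ≤
      9 * (h m + g m + j m + 2 * (k (m + 1) - 1) * h m) := by linarith
  have := mul_le_mul_of_nonneg_right this hc.le
  linarith

theorem freq_lower (P : Profile k R h g j a b c E) (m : ℕ) : k (m + 1) * (b m + c m) ≤ a m := by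
  by_cases hR : R (m + 1)
  · have := (P.freq.one m hR).2
    linarith [(P.order (m + 1)).1]
  · have := (P.freq.two m hR).2
    linarith [(P.order (m + 1)).1, (P.order (m + 1)).2.1]

theorem freq_upper (P : Profile k R h g j a b c E) {K : ℕ} (m : ℕ) (hK : k (m + 1) ≤ K) :
    a m ≤ (2 * K + 1) * a (m + 1) := by
  have e := P.freq.a_succ m
  obtain ⟨o₁, o₂, o₃⟩ := P.order m
  obtain ⟨o₁', o₂', o₃'⟩ := P.order (m + 1)
  have hK' : (k (m + 1) : ℝ) ≤ K := by exact_mod_cast hK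
  have h₁ : k (m + 1) * (b m + c m) ≤ K * (b m + b m) :=
    mul_le_mul hK' (by linarith) (by linarith) (Nat.cast_nonneg K)
  rw [e]
  by_cases hR : R (m + 1)
  · have := (P.freq.one m hR).2
    linarith
  · have := (P.freq.two m hR).2
    linarith

theorem c_succ_le (P : Profile k R h g j a b c E) (m : ℕ) : c (m + 1) ≤ c m := by
  by_cases hR : R (m + 1)
  · have := (P.freq.one m hR).1
    linarith [(P.order (m + 1)).2.1]
  · exact (P.freq.two m hR).1.le

/-- Since ha ≤ 1 and h + g + j ≤ 4h, the product (h + g + j)c is at most 4c/a. -/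
theorem limsup_eq_top (P : Profile k R h g j a b c E)
    (H : ∀ C M : ℕ, ∃ m ≥ M, C * c m ≤ a m) :
    limsup (fun N : ℕ => ((N : ℝ≥0∞) * E N)⁻¹) atTop = ⊤ := by
  refine ENNReal.eq_top_of_forall_nnreal_le fun r => ?_
  obtain ⟨T, hT⟩ := exists_nat_gt (r : ℝ)
  have hT₀ : (0 : ℝ) < T := r.2.trans_lt hT
  refine le_trans ?_ (P.le_limsup' hT₀ fun M => ?_)
  · rw [← ENNReal.ofReal_coe_nnreal]
    exact ENNReal.ofReal_le_ofReal hT.le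
  · obtain ⟨m, hm, h'⟩ := H (2 * T) M
    refine ⟨m, hm, ?_⟩
    obtain ⟨u₁, u₂, u₃, u₄, u₅, u₆⟩ := P.bounds m
    obtain ⟨o₁, o₂, o₃⟩ := P.order m
    have h₁ : h m + g m + j m ≤ 4 * h m := by rcases u₆ with u | u <;> linarith
    have h₂ : h m * a m ≤ 1 := by
      have := P.pairing m
      have := mul_pos u₂ (o₁.trans_le o₂)
      have := mul_pos u₃ o₁
      linarith
    push_cast at h'
    have h₃ := mul_le_mul_of_nonneg_left h' u₁.le
    have h₄ := mul_le_mul_of_nonneg_right h₁ (mul_pos hT₀ o₁).le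
    linarith

theorem limsup_eq_top_of_k (P : Profile k R h g j a b c E)
    (H : ∀ C M : ℕ, ∃ m ≥ M, C < k (m + 1)) :
    limsup (fun N : ℕ => ((N : ℝ≥0∞) * E N)⁻¹) atTop = ⊤ := by
  refine P.limsup_eq_top fun C M => ?_
  obtain ⟨m, hm, h'⟩ := H C M
  refine ⟨m, hm, (le_trans ?_ (P.freq_lower m))⟩
  obtain ⟨o₁, o₂, o₃⟩ := P.order m
  have : (C : ℝ) ≤ k (m + 1) := by exact_mod_cast h'.le
  exact mul_le_mul this (by linarith) o₁.le (Nat.cast_nonneg _)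

/-- Along unmarked steps c is constant, while each step lowers a by at least c; a long run therefore
starts with a large a/c. -/
theorem limsup_eq_top_of_run (P : Profile k R h g j a b c E)
    (H : ∀ C M : ℕ, ∃ m ≥ M, ∀ d < C, ¬ R (m + d + 1)) :
    limsup (fun N : ℕ => ((N : ℝ≥0∞) * E N)⁻¹) atTop = ⊤ := by
  refine P.limsup_eq_top fun C M => ?_
  obtain ⟨m, hm, h'⟩ := H C M
  refine ⟨m, hm, ?_⟩
  have key : ∀ d ≤ C, c (m + d) = c m ∧ a (m + d) + d * c m ≤ a m := by
    intro d
    induction d with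
    | zero => simp
    | succ d ih =>
      intro hd
      obtain ⟨i₁, i₂⟩ := ih (by omega)
      have hc := (P.freq.two (m + d) (h' d (by omega))).1
      have hl := P.freq_lower (m + d)
      obtain ⟨o₁, o₂, o₃⟩ := P.order (m + d)
      have hk := mul_le_mul_of_nonneg_right (P.one_le_k' (m + d))
        (by linarith : 0 ≤ b (m + d) + c (m + d))
      have e := P.freq.a_succ (m + d)
      rw [← add_assoc]
      refine ⟨hc.trans i₁, ?_⟩
      push_cast
      linarith
  obtain ⟨-, h₂⟩ := key C le_rfl
  obtain ⟨o₁, o₂, o₃⟩ := P.order (m + C)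
  linarith

/-- A mark at p + 1 gives a_{p+2} = c_p ≤ c_{m+1}, and each step divides a by at most 2K + 1. A mark
within bounded distance thus bounds a_m by a constant times c_{m+1}. -/
theorem limsup_ne_top (P : Profile k R h g j a b c E) {K G M : ℕ} (hK : ∀ m, k (m + 1) ≤ K)
    (hG : ∀ m ≥ M, ∃ p, m ≤ p ∧ p ≤ m + G ∧ R (p + 1)) :
    limsup (fun N : ℕ => ((N : ℝ≥0∞) * E N)⁻¹) atTop ≠ ⊤ := by
  have hK₁ : (1 : ℝ) ≤ 2 * K + 1 := by
    have : (0 : ℝ) ≤ K := Nat.cast_nonneg K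
    linarith
  have hpow : (0 : ℝ) < (2 * K + 1) ^ (G + 3) := by positivity
  refine ne_top_of_le_ne_top ENNReal.ofReal_ne_top
    (P.limsup_le (T := 2 * (2 * K + 1) ^ (G + 3)) (by linarith) M fun m hm => ?_)
  obtain ⟨p, hp₁, hp₂, hp₃⟩ := hG (m + 1) (by omega)
  have ha : ∀ d, a m ≤ (2 * K + 1) ^ d * a (m + d) := by
    intro d
    induction d with
    | zero => simp
    | succ d ih =>
      refine ih.trans ?_
      rw [pow_succ, mul_assoc]
      exact mul_le_mul_of_nonneg_left (P.freq_upper (m + d) (hK _)) (by positivity)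
  have hc : c p ≤ c (m + 1) := (antitone_nat_of_succ_le P.c_succ_le) hp₁
  have e : a (p + 2) = c p := by
    rw [P.freq.a_succ (p + 1), (P.freq.one p hp₃).1]
  have h₁ := ha (p + 2 - m)
  rw [show m + (p + 2 - m) = p + 2 by omega, e] at h₁
  have h₂ : (2 * K + 1 : ℝ) ^ (p + 2 - m) ≤ (2 * K + 1) ^ (G + 3) :=
    pow_le_pow_right₀ hK₁ (by omega)
  have o₁ := (P.order p).1
  have h₃ : a m ≤ (2 * K + 1 : ℝ) ^ (G + 3) * c (m + 1) :=
    h₁.trans (mul_le_mul h₂ hc o₁.le hpow.le)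
  obtain ⟨u₁, u₂, u₃, -⟩ := P.bounds m
  obtain ⟨q₁, q₂, q₃⟩ := P.order m
  have q₄ := (P.order (m + 1)).1
  have F := P.pairing m
  have h₄ : 1 ≤ (h m + g m + j m) * a m := by
    have := mul_le_mul_of_nonneg_left (by linarith : b m ≤ a m) u₂.le
    have := mul_le_mul_of_nonneg_left (by linarith : c m ≤ a m) u₃.le
    linarith
  have h₅ : (h m + g m + j m) * a m ≤
      (h m + g m + j m + 1) * ((2 * K + 1 : ℝ) ^ (G + 3) * c (m + 1)) :=
    mul_le_mul (by linarith) h₃ (by linarith) (by linarith)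
  linarith

end Profile

theorem IsParameter.strictMono_n {k n : ℕ → ℕ} (hp : IsParameter k n) {i i' : ℕ} (hi : 1 ≤ i)
    (h : i < i') : n i < n i' := by
  induction i', h using Nat.le_induction with
  | base => exact hp.n_lt_succ i hi
  | succ m hm ih => exact ih.trans (hp.n_lt_succ m (by omega))

theorem exists_ge_of_unbounded {f : ℕ → ℕ} (H : ∀ C, ∃ m, C < f m) (C M : ℕ) :
    ∃ m ≥ M, C < f m := by
  -- A value above the sum of the first M values is not one of them.
  obtain ⟨m, hm⟩ := H (C + ∑ i ∈ Finset.range M, f i)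
  refine ⟨m, ?_, by omega⟩
  by_contra! hlt
  have := Finset.single_le_sum (f := f) (fun i _ => Nat.zero_le _) (Finset.mem_range.2 hlt)
  omega

theorem IsParameter.exists_run {k n : ℕ → ℕ} (hp : IsParameter k n)
    (H : ∀ C : ℕ, ∃ i, 1 ≤ i ∧ C < n (i + 1) - n i) (C M : ℕ) :
    ∃ m ≥ M, ∀ d < C, ¬ IsMark n (m + d + 1) := by
  obtain ⟨i, hi, h'⟩ := exists_ge_of_unbounded (f := fun i => n (i + 1 + 1) - n (i + 1))
    (fun C => by
      obtain ⟨i, hi, h'⟩ := H C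
      exact ⟨i - 1, by rwa [Nat.sub_add_cancel hi]⟩) C M
  refine ⟨n (i + 1), by have := hp.le_n (i + 1) (by omega); omega, ?_⟩
  rintro d hd ⟨q, hq, e⟩
  rcases le_or_gt q (i + 1) with hlt | hgt
  · rcases hlt.eq_or_lt with rfl | hlt
    · omega
    · have := hp.strictMono_n hq hlt
      omega
  · rcases (Nat.succ_le_of_lt hgt).eq_or_lt with rfl | hlt
    · simp only [Nat.succ_eq_add_one] at e
      omega
    · have := hp.strictMono_n (by omega) hlt
      simp only [Nat.succ_eq_add_one] at this
      omega

theorem IsParameter.exists_mark_le {k n : ℕ → ℕ} (hp : IsParameter k n) {G : ℕ}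
    (H : ∀ i, 1 ≤ i → n (i + 1) - n i ≤ G) {m : ℕ} (hm : n 1 ≤ m) :
    ∃ p, m ≤ p ∧ p ≤ m + G ∧ IsMark n (p + 1) := by
  have hex : ∃ i, m < n (i + 1) := ⟨m, by have := hp.le_n (m + 1) (by omega); omega⟩
  classical
  have hi := Nat.find_spec hex
  obtain ⟨i, hi'⟩ := Nat.exists_eq_succ_of_ne_zero (n := Nat.find hex) fun h₀ => by
    rw [h₀] at hi
    simp only [zero_add] at hi
    omega
  have hmin := Nat.find_min hex (m := i) (by omega)
  rw [hi', Nat.succ_eq_add_one] at hi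
  have := H (i + 1) (by omega)
  exact ⟨n (i + 1 + 1) - 1, by omega, by omega, i + 1 + 1, by omega, by omega⟩

theorem IsParameter.hasUpperBL {k n : ℕ → ℕ} (hp : IsParameter k n) :
    ∃ μ, IsInvariantProbability (language k n) μ ∧
      HasUpperBL (language k n) (upperBLOf (language k n) μ) := by
  obtain ⟨y, hy⟩ := hp.exists_mem_symbolicSpace
  obtain ⟨μ, hμ⟩ := exists_isInvariantProbability hy
  exact ⟨μ, hμ, μ, hμ, fun ν hν => hp.invariant_unique hμ hν, rfl⟩

theorem IsParameter.upperBLOf_eq_top_iff {k n : ℕ → ℕ} (hp : IsParameter k n)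
    {μ : Measure (ℕ → Letter)} (hμ : IsInvariantProbability (language k n) μ) :
    upperBLOf (language k n) μ = ⊤ ↔
      (∀ C : ℕ, ∃ m, 1 ≤ m ∧ C < k m) ∨ (∀ C : ℕ, ∃ i, 1 ≤ i ∧ C < n (i + 1) - n i) := by
  have P := hp.profile hμ
  constructor
  · intro htop
    by_contra! hcon
    obtain ⟨⟨K, hK⟩, G, hG⟩ := hcon
    exact P.limsup_ne_top (K := K) (G := G) (M := n 1) (fun m => hK _ (by omega))
      (fun m hm => hp.exists_mark_le hG hm) htop
  · rintro (H | H)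
    · refine P.limsup_eq_top_of_k fun C M => exists_ge_of_unbounded
        (f := fun m => k (m + 1)) (fun C => ?_) C M
      obtain ⟨m, hm, h'⟩ := H C
      exact ⟨m - 1, by rwa [Nat.sub_add_cancel hm]⟩
    · exact P.limsup_eq_top_of_run (hp.exists_run H)

theorem top_mem_upperBLSpectrum : ⊤ ∈ upperBLSpectrum := by
  have hp : IsParameter (fun m => m) (fun i => i) := ⟨fun m hm => hm, le_rfl, fun i _ => by omega⟩
  obtain ⟨μ, hμ, hB⟩ := hp.hasUpperBL
  rw [(hp.upperBLOf_eq_top_iff hμ).2 (Or.inl fun C => ⟨C + 1, by omega, by simp⟩)] at hB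
  exact ⟨_, _, hp, hB⟩

end ArnouxRauzy

/-! ### Eventually Tribonacci systems -/

namespace ArnouxRauzy

/-- Six decimals of y are kept, because the four-decimal bounds for the value need more than y ∈
(1.8392, 1.8393). -/
theorem exists_tribonacci_root :
    ∃ y : ℝ, y ^ 3 - y ^ 2 - y - 1 = 0 ∧ 1.839285 < y ∧ y < 1.839288 := by
  have hcont : ContinuousOn (fun y : ℝ => y ^ 3 - y ^ 2 - y - 1) (Set.Icc 1.839285 1.839288) := by
    fun_prop
  obtain ⟨y, ⟨h₁, h₂⟩, hy⟩ := intermediate_value_Ioo (by norm_num) hcont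
    (show (0 : ℝ) ∈ Set.Ioo _ _ by norm_num)
  exact ⟨y, hy, h₁, h₂⟩

theorem tribonacci_root_unique {y z : ℝ} (hy : y ^ 3 - y ^ 2 - y - 1 = 0) (h₁ : 1.8392 < y)
    (h₂ : y < 1.8393) : z ^ 3 - z ^ 2 - z - 1 = 0 ↔ z = y := by
  refine ⟨fun hz => ?_, fun h => h ▸ hy⟩
  have : (z - y) * (z ^ 2 + z * (y - 1) + (y ^ 2 - y - 1)) = 0 := by linear_combination hz - hy
  rcases mul_eq_zero.1 this with h | h
  · linarith
  · nlinarith [sq_nonneg (2 * z + (y - 1))]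

section Recursion

variable {y : ℝ}

/-- The norm form of the two complex roots. -/
theorem normForm_step {p q r z : ℝ} (h : p = -((y - 1) * q) - z * r) :
    p ^ 2 + (y - 1) * p * q + z * q ^ 2 = z * (q ^ 2 + (y - 1) * q * r + z * r ^ 2) := by
  subst h; ring

theorem le_normForm (h₁ : 1.8392 < y) (h₂ : y < 1.8393) (q r : ℝ) :
    0.3 * r ^ 2 ≤ q ^ 2 + (y - 1) * q * r + (y ^ 2 - y - 1) * r ^ 2 := by
  have : 0.3 ≤ (y ^ 2 - y - 1) - (y - 1) ^ 2 / 4 := by nlinarith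
  nlinarith [sq_nonneg (q + (y - 1) / 2 * r), mul_le_mul_of_nonneg_right this (sq_nonneg r)]

/-- The recurrence comes from the quotient of X³ − X² − X − 1 by X − y. It multiplies the positive
definite norm form by y² − y − 1 = 1/y < 1 when y is the root, so the form stays bounded. -/
theorem bounded_of_forward (h₁ : 1.8392 < y) (h₂ : y < 1.8393) {v : ℕ → ℝ} {M : ℕ}
    (hv : ∀ m ≥ M, v (m + 2) = -((y - 1) * v (m + 1)) - (y ^ 2 - y - 1) * v m) :
    ∃ K, ∀ m ≥ M, |v m| ≤ K := by
  set Q : ℕ → ℝ := fun m =>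
    v (m + 1) ^ 2 + (y - 1) * v (m + 1) * v m + (y ^ 2 - y - 1) * v m ^ 2 with hQ
  have hQ₀ : ∀ m, 0.3 * v m ^ 2 ≤ Q m := fun m => le_normForm h₁ h₂ _ _
  have hz : y ^ 2 - y - 1 ≤ 1 := by nlinarith
  have hQM : ∀ m ≥ M, Q m ≤ Q M := by
    intro m hm
    induction m, hm using Nat.le_induction with
    | base => exact le_rfl
    | succ m hm ih =>
      have e : Q (m + 1) = (y ^ 2 - y - 1) * Q m := normForm_step (hv m hm)
      have : 0 ≤ Q m := (by positivity : (0 : ℝ) ≤ 0.3 * v m ^ 2).trans (hQ₀ m)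
      rw [e]
      nlinarith
  -- The inequality 2|v| ≤ v² + 1 replaces a square root.
  refine ⟨Q M / 0.3 + 1, fun m hm => ?_⟩
  have h₃ : v m ^ 2 ≤ Q M / 0.3 := by
    rw [le_div_iff₀ (by norm_num)]
    linarith [hQ₀ m, hQM m hm]
  rw [← sq_abs] at h₃
  nlinarith [sq_nonneg (|v m| - 1), abs_nonneg (v m)]

/-- Here the form at m is (y² − y − 1)^t times the form at m + t, which is bounded; letting t grow
makes it vanish. -/
theorem eq_zero_of_backward (h₁ : 1.8392 < y) (h₂ : y < 1.8393) {w : ℕ → ℝ} {M : ℕ} {A : ℝ}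
    (hw : ∀ m ≥ M, w m = -((y - 1) * w (m + 1)) - (y ^ 2 - y - 1) * w (m + 2))
    (hA : ∀ m, |w m| ≤ A) {m : ℕ} (hm : M ≤ m) : w (m + 1) = 0 := by
  set Q : ℕ → ℝ := fun m =>
    w m ^ 2 + (y - 1) * w m * w (m + 1) + (y ^ 2 - y - 1) * w (m + 1) ^ 2 with hQ
  have hz : y ^ 2 - y - 1 < 1 := by nlinarith
  have hz₀ : 0 ≤ y ^ 2 - y - 1 := by nlinarith
  have hstep : ∀ t, Q m = (y ^ 2 - y - 1) ^ t * Q (m + t) := by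
    intro t
    induction t with
    | zero => simp
    | succ t ih =>
      have e : Q (m + t) = (y ^ 2 - y - 1) * Q (m + t + 1) :=
        normForm_step (hw (m + t) (by omega))
      rw [ih, e, pow_succ (y ^ 2 - y - 1), mul_assoc, add_assoc]
  have hbd : ∀ i, Q i ≤ 3 * A ^ 2 := by
    intro i
    have s₁ : w i ^ 2 ≤ A ^ 2 := sq_le_sq' (abs_le.1 (hA i)).1 (abs_le.1 (hA i)).2
    have s₂ : w (i + 1) ^ 2 ≤ A ^ 2 := sq_le_sq' (abs_le.1 (hA _)).1 (abs_le.1 (hA _)).2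
    have s₃ : w i * w (i + 1) ≤ A ^ 2 := by nlinarith [sq_nonneg (w i - w (i + 1))]
    have s₄ : (y - 1) * (w i * w (i + 1)) ≤ (y - 1) * A ^ 2 :=
      mul_le_mul_of_nonneg_left s₃ (by linarith)
    have s₅ : (y ^ 2 - y - 1) * w (i + 1) ^ 2 ≤ 1 * A ^ 2 :=
      mul_le_mul hz.le s₂ (sq_nonneg _) zero_le_one
    simp only [hQ]
    nlinarith [sq_nonneg A]
  have hlim : Tendsto (fun t : ℕ => (y ^ 2 - y - 1) ^ t * (3 * A ^ 2)) atTop (nhds 0) := by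
    simpa using (tendsto_pow_atTop_nhds_zero_of_lt_one hz₀ hz).mul_const (3 * A ^ 2)
  have hQm : Q m ≤ 0 := ge_of_tendsto' hlim fun t => by
    rw [hstep t]
    exact mul_le_mul_of_nonneg_left (hbd _) (pow_nonneg hz₀ t)
  have := le_normForm h₁ h₂ (w m) (w (m + 1))
  have h₃ : w (m + 1) ^ 2 ≤ 0 := by
    simp only [hQ] at hQm
    linarith
  exact pow_eq_zero_iff two_ne_zero |>.1 (le_antisymm h₃ (sq_nonneg _))

end Recursion

namespace Profile

variable {k : ℕ → ℕ} {R : ℕ → Prop} {h g j a b c : ℕ → ℝ} {E : ℕ → ℝ≥0∞} {y : ℝ}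

/-- The defect a_m − y a_{m+1} satisfies the backward recurrence and is bounded since a is positive
and decreasing. Hence it is zero and a is exactly geometric. -/
theorem tribonacci_freq (P : Profile k R h g j a b c E) (hy : y ^ 3 - y ^ 2 - y - 1 = 0)
    (h₁ : 1.8392 < y) (h₂ : y < 1.8393) {M : ℕ} (hT : ∀ m ≥ M, R (m + 1) ∧ k (m + 1) = 1) {m : ℕ}
    (hm : M < m) : a m = y ^ 3 * c (m + 1) ∧ b m = y ^ 2 * c (m + 1) ∧ c m = y * c (m + 1) := by
  have hb : ∀ m, b m = a (m + 1) := fun m => (P.freq.a_succ m).symm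
  have hc : ∀ m ≥ M, c m = a (m + 2) := fun m hm => by
    rw [← (P.freq.one m (hT m hm).1).1, hb]
  have ha : ∀ m ≥ M, a m = a (m + 1) + a (m + 2) + a (m + 3) := fun m hm => by
    have := (P.freq.one m (hT m hm).1).2
    rw [(hT m hm).2, hb, hc m hm, hc (m + 1) (by omega)] at this
    push_cast at this
    linarith
  have hpos : ∀ m, 0 < a m := fun m => by
    obtain ⟨o₁, o₂, o₃⟩ := P.order m
    linarith
  have hanti : Antitone a := antitone_nat_of_succ_le fun m => by
    obtain ⟨o₁, o₂, o₃⟩ := P.order m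
    linarith [hb m]
  have key : ∀ m, M < m → a m = y * a (m + 1) := by
    intro m hm
    obtain ⟨m, rfl⟩ : ∃ m', m = m' + 1 := ⟨m - 1, by omega⟩
    have := eq_zero_of_backward h₁ h₂ (w := fun m => a m - y * a (m + 1)) (M := M) (A := 2 * a 0)
      (fun m hm => by
        have := ha m hm
        simp only [add_assoc, Nat.reduceAdd] at *
        linear_combination this - a (m + 3) * hy)
      (fun m => by
        have q₁ := hpos m
        have q₂ := hpos (m + 1)
        have q₃ := hanti (Nat.zero_le m)
        have q₄ := hanti (Nat.zero_le (m + 1))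
        have q₅ : y * a (m + 1) ≤ 2 * a 0 := mul_le_mul (by linarith) q₄ q₂.le (by norm_num)
        have q₆ : 0 ≤ y * a (m + 1) := mul_nonneg (by linarith) q₂.le
        rw [abs_le]
        constructor <;> linarith) (m := m) (by omega)
    linarith
  rw [hb, hc m hm.le, hc (m + 1) (by omega), key m hm, key (m + 1) (by omega),
    key (m + 2) (by omega)]
  refine ⟨by ring, by ring, by ring⟩

/-- The defects h_{m+1} − y h_m satisfy the forward recurrence, so they are only bounded; this
suffices because c tends to 0. -/
theorem tribonacci_length (P : Profile k R h g j a b c E) (hy : y ^ 3 - y ^ 2 - y - 1 = 0)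
    (h₁ : 1.8392 < y) (h₂ : y < 1.8393) {M : ℕ} (hT : ∀ m ≥ M, R (m + 1) ∧ k (m + 1) = 1) :
    ∃ K, ∀ m ≥ M, ∃ v₀ v₁ : ℝ, |v₀| ≤ K ∧ |v₁| ≤ K ∧ g m = (y - 1) * h m + v₀ ∧
      j m = (y ^ 2 - y - 1) * h m + v₁ + (y - 1) * v₀ := by
  have hh : ∀ m ≥ M, h (m + 1) = g m + h m ∧ g (m + 1) = j m + h m ∧ j (m + 1) = h m := by
    intro m hm
    have e₁ := P.length.h_succ m
    obtain ⟨e₂, e₃⟩ := P.length.one m (hT m hm).1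
    rw [(hT m hm).2, Nat.cast_one, one_mul] at e₁ e₂
    exact ⟨e₁, e₂, e₃⟩
  obtain ⟨K, hK⟩ := bounded_of_forward h₁ h₂ (v := fun m => h (m + 1) - y * h m) (M := M)
    (fun m hm => by
      have e₁ := (hh m hm).2.2
      have e₂ := (hh (m + 1) (by omega)).2.1
      have e₃ := (hh (m + 2) (by omega)).1
      simp only [add_assoc, Nat.reduceAdd] at *
      linear_combination e₃ + e₂ + e₁ - h m * hy)
  refine ⟨K, fun m hm => ⟨_, _, hK m hm, hK (m + 1) (by omega), ?_, ?_⟩⟩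
  · linarith [(hh m hm).1]
  · have e₂ := (hh m hm).2.1
    have e₃ := (hh (m + 1) (by omega)).1
    simp only [add_assoc, Nat.reduceAdd] at *
    linear_combination - e₃ - e₂

theorem tendsto_tribonacci (P : Profile k R h g j a b c E) (hy : y ^ 3 - y ^ 2 - y - 1 = 0)
    (h₁ : 1.8392 < y) (h₂ : y < 1.8393) {M : ℕ} (hT : ∀ m ≥ M, R (m + 1) ∧ k (m + 1) = 1) :
    Tendsto (fun m => (h m + g m + j m + 1) * c (m + 1)) atTop
      (nhds ((y ^ 2 - 1) / (y ^ 2 + 2 * y + 3))) := by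
  obtain ⟨K, hK⟩ := P.tribonacci_length hy h₁ h₂ hT
  -- Up to bounded errors in the lengths, ha + gb + jc is α h_m c_{m+1} and h + g + j is β h_m; p
  -- and q are the coefficients of the errors v₀ and v₁.
  set α := y ^ 2 + 2 * y + 3 with hα
  set β := y ^ 2 - 1
  set p := α * y - β * (2 * y ^ 2 - y)
  set q := α - β * y
  have hα₀ : 0 < α := by positivity
  have hbound : ∀ m > M, |(h m + g m + j m + 1) * c (m + 1) * α - β| ≤
      (|p| * K + |q| * K + α) * (1 / (m : ℝ)) := by
    intro m hm
    obtain ⟨v₀, v₁, hv₀, hv₁, eg, ej⟩ := hK m hm.le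
    obtain ⟨f₁, f₂, f₃⟩ := P.tribonacci_freq hy h₁ h₂ hT hm
    have F := P.pairing m
    obtain ⟨u₁, u₂, u₃, -⟩ := P.bounds m
    obtain ⟨o₁, o₂, o₃⟩ := P.order m
    have hc := (P.order (m + 1)).1
    have hm₀ : (0 : ℝ) < m := by exact_mod_cast (by omega : 0 < m)
    have hcm : c (m + 1) ≤ 1 / m := by
      rw [le_div_iff₀ hm₀]
      have q₁ := P.lt_h m
      have q₂ : c (m + 1) ≤ a m := by
        have := P.c_succ_le m
        linarith
      have q₃ := mul_pos u₂ (o₁.trans_le o₂)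
      have q₄ := mul_pos u₃ o₁
      have q₅ := mul_le_mul q₂ q₁.le hm₀.le (by linarith)
      linarith
    have e : (h m + g m + j m + 1) * c (m + 1) * α - β = (p * v₀ + q * v₁ + α) * c (m + 1) := by
      rw [f₁, f₂, f₃] at F
      rw [eg, ej] at F ⊢
      have : c (m + 1) * (α * h m + y ^ 2 * v₀ + y * (v₁ + (y - 1) * v₀)) = 1 := by
        linear_combination F - 3 * h m * c (m + 1) * hy
      linear_combination β * this
    rw [e, abs_mul, abs_of_pos hc]
    have hp : |p * v₀| ≤ |p| * K := by
      rw [abs_mul]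
      exact mul_le_mul_of_nonneg_left hv₀ (abs_nonneg p)
    have hq : |q * v₁| ≤ |q| * K := by
      rw [abs_mul]
      exact mul_le_mul_of_nonneg_left hv₁ (abs_nonneg q)
    have hs : |p * v₀ + q * v₁ + α| ≤ |p| * K + |q| * K + α := by
      have t₁ := abs_add_le (p * v₀ + q * v₁) α
      have t₂ := abs_add_le (p * v₀) (q * v₁)
      rw [abs_of_pos hα₀] at t₁
      linarith
    exact mul_le_mul hs hcm hc.le ((abs_nonneg _).trans hs)
  have hlim : Tendsto (fun m : ℕ => (|p| * K + |q| * K + α) * (1 / (m : ℝ))) atTop (nhds 0) := by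
    simpa using tendsto_one_div_atTop_nhds_zero_nat.const_mul (|p| * K + |q| * K + α)
  have h₀ : Tendsto (fun m => (h m + g m + j m + 1) * c (m + 1) * α - β) atTop (nhds 0) :=
    squeeze_zero_norm' (eventually_atTop.2 ⟨M + 1, fun m hm => hbound m hm⟩) hlim
  have h₃ := (h₀.add_const β).div_const α
  rw [zero_add] at h₃
  refine h₃.congr fun m => ?_
  rw [sub_add_cancel, mul_div_assoc, div_self hα₀.ne', mul_one]

/-- Only the tail of the parameters matters, so all eventually Tribonacci systems share one value.
Both bounds on the limsup involve the same convergent product, whose limit is 2/B. -/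
theorem limsup_tribonacci (P : Profile k R h g j a b c E) (hy : y ^ 3 - y ^ 2 - y - 1 = 0)
    (h₁ : 1.8392 < y) (h₂ : y < 1.8393) {M : ℕ} (hT : ∀ m ≥ M, R (m + 1) ∧ k (m + 1) = 1) :
    limsup (fun N : ℕ => ((N : ℝ≥0∞) * E N)⁻¹) atTop =
      ENNReal.ofReal (2 * y ^ 2 + 4 * y / (y ^ 2 + 1)) := by
  have hy₀ : 0 < y := by linarith
  have hβ : 0 < y ^ 2 - 1 := by nlinarith
  set B := 2 * y ^ 2 + 4 * y / (y ^ 2 + 1) with hB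
  have hB₀ : 0 < B := by positivity
  have hlim := P.tendsto_tribonacci hy h₁ h₂ hT
  have e : (y ^ 2 - 1) / (y ^ 2 + 2 * y + 3) = 2 / B := by
    rw [div_eq_div_iff (by positivity) hB₀.ne', hB]
    field_simp
    linear_combination (2 * y ^ 3 + 2 * y ^ 2 + 2 * y + 6) * hy
  rw [e] at hlim
  apply le_antisymm
  · by_contra! hlt
    obtain ⟨T, hT₁, hT₂⟩ := ENNReal.lt_iff_exists_nnreal_btwn.1 hlt
    rw [← ENNReal.ofReal_coe_nnreal] at hT₁ hT₂
    have hT₃ : B < T := lt_of_not_ge fun h' => hT₁.not_ge (ENNReal.ofReal_le_ofReal h')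
    have hT₀ : (0 : ℝ) < T := hB₀.trans hT₃
    have hev := hlim.eventually (lt_mem_nhds
      (show 2 / (T : ℝ) < 2 / B from div_lt_div_of_pos_left two_pos hB₀ hT₃))
    obtain ⟨M', hM'⟩ := eventually_atTop.1 hev
    refine (P.limsup_le hT₀ M' fun m hm => ?_).not_gt hT₂
    have := hM' m hm
    rw [div_lt_iff₀ hT₀] at this
    linarith
  · by_contra! hlt
    obtain ⟨T, hT₁, hT₂⟩ := ENNReal.lt_iff_exists_nnreal_btwn.1 hlt
    have hT₀ : (0 : ℝ) < T := by
      have : (0 : ℝ≥0∞) < T := bot_le.trans_lt hT₁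
      exact_mod_cast this
    rw [← ENNReal.ofReal_coe_nnreal] at hT₁ hT₂
    have hT₃ : T < B := lt_of_not_ge fun h' => hT₂.not_ge (ENNReal.ofReal_le_ofReal h')
    have hev := hlim.eventually (gt_mem_nhds
      (show 2 / B < 2 / (T : ℝ) from div_lt_div_of_pos_left two_pos hT₀ hT₃))
    obtain ⟨M', hM'⟩ := eventually_atTop.1 hev
    refine (P.le_limsup hT₀ fun M₁ => ⟨max M (max M' M₁), by omega, ?_⟩).not_gt hT₁
    have := hM' (max M (max M' M₁)) (by omega)
    rw [(hT (max M (max M' M₁)) (by omega)).2, Nat.cast_one, sub_self, mul_zero, zero_mul,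
      add_zero]
    rw [lt_div_iff₀ hT₀] at this
    linarith

end Profile

theorem tribonacci_value_bounds {y : ℝ} (hy : y ^ 3 - y ^ 2 - y - 1 = 0) (h₁ : 1.839285 < y)
    (h₂ : y < 1.839288) : 8.4445 < 2 * y ^ 2 + 4 * y / (y ^ 2 + 1) ∧
      2 * y ^ 2 + 4 * y / (y ^ 2 + 1) < 8.4446 := by
  have hpos : 0 < y ^ 2 + 1 := by positivity
  -- Lowers the degree once the denominator y² + 1 is cleared.
  have hy₄ : y ^ 4 = 2 * y ^ 2 + 2 * y + 1 := by linear_combination (y + 1) * hy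
  constructor
  · have : 8.4445 - 2 * y ^ 2 < 4 * y / (y ^ 2 + 1) := by
      rw [lt_div_iff₀ hpos]
      nlinarith
    linarith
  · have : 4 * y / (y ^ 2 + 1) < 8.4446 - 2 * y ^ 2 := by
      rw [div_lt_iff₀ hpos]
      nlinarith
    linarith

theorem eq_or_le_of_mem_upperBLSpectrum {y : ℝ} (hy : y ^ 3 - y ^ 2 - y - 1 = 0)
    (h₁ : 1.8392 < y) (h₂ : y < 1.8393) {B : ℝ≥0∞} (hB : B ∈ upperBLSpectrum) :
    B = ENNReal.ofReal (2 * y ^ 2 + 4 * y / (y ^ 2 + 1)) ∨ ENNReal.ofReal (181 / 21) ≤ B := by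
  obtain ⟨k, n, hp, μ, hμ, -, rfl⟩ := hB
  have P := hp.profile hμ
  by_cases hT : ∃ M, ∀ m ≥ M, IsMark n (m + 1) ∧ k (m + 1) = 1
  · obtain ⟨M, hM⟩ := hT
    exact Or.inl (P.limsup_tribonacci hy h₁ h₂ hM)
  · exact Or.inr (P.le_limsup_of_gap hT)

theorem isParameter_tribonacci : IsParameter (fun _ => 1) (fun i => i) :=
  ⟨fun _ _ => le_rfl, le_rfl, fun i _ => by omega⟩

theorem hasUpperBL_tribonacci {y : ℝ} (hy : y ^ 3 - y ^ 2 - y - 1 = 0)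
    (h₁ : 1.8392 < y) (h₂ : y < 1.8393) :
    HasUpperBL (language (fun _ => 1) (fun i => i))
      (ENNReal.ofReal (2 * y ^ 2 + 4 * y / (y ^ 2 + 1))) := by
  obtain ⟨μ, hμ, hB⟩ := isParameter_tribonacci.hasUpperBL
  have e := (isParameter_tribonacci.profile hμ).limsup_tribonacci hy h₁ h₂ (M := 0)
    fun m _ => ⟨⟨m + 1, by omega, rfl⟩, rfl⟩
  rwa [upperBLOf, e] at hB

end ArnouxRauzy
theorem mainTheorem8 :
    (∀ k n : ℕ → ℕ, ArnouxRauzy.IsParameter k n →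
      ∃ B : ℝ≥0∞, ArnouxRauzy.HasUpperBL (ArnouxRauzy.language k n) B ∧
        (B = ⊤ ↔
          (∀ C : ℕ, ∃ m, 1 ≤ m ∧ C < k m) ∨
          (∀ C : ℕ, ∃ i, 1 ≤ i ∧ C < n (i + 1) - n i))) ∧
    ⊤ ∈ ArnouxRauzy.upperBLSpectrum ∧
    ∃ y b : ℝ,
      (∀ z : ℝ, z ^ 3 - z ^ 2 - z - 1 = 0 ↔ z = y) ∧
      1.8392 < y ∧ y < 1.8393 ∧
      b = 2 * y ^ 2 + 4 * y / (y ^ 2 + 1) ∧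
      8.4445 < b ∧ b < 8.4446 ∧
      ArnouxRauzy.HasUpperBL (ArnouxRauzy.language (fun _ => 1) (fun i => i))
        (ENNReal.ofReal b) ∧
      IsLeast ArnouxRauzy.upperBLSpectrum (ENNReal.ofReal b) ∧
      b < 181 / 21 ∧
      (∀ B ∈ ArnouxRauzy.upperBLSpectrum, B < ENNReal.ofReal (181 / 21) →
        B = ENNReal.ofReal b) := by
  obtain ⟨y, hy, h₁, h₂⟩ := ArnouxRauzy.exists_tribonacci_root
  have l₁ : 1.8392 < y := by linarith
  have l₂ : y < 1.8393 := by linarith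
  obtain ⟨b₁, b₂⟩ := ArnouxRauzy.tribonacci_value_bounds hy h₁ h₂
  have hT := ArnouxRauzy.hasUpperBL_tribonacci hy l₁ l₂
  have hb : 2 * y ^ 2 + 4 * y / (y ^ 2 + 1) < 181 / 21 := b₂.trans (by norm_num)
  refine ⟨fun k n hp => ?_, ArnouxRauzy.top_mem_upperBLSpectrum, y, _,
    fun z => ArnouxRauzy.tribonacci_root_unique hy l₁ l₂, l₁, l₂, rfl, b₁, b₂, hT,
    ⟨⟨_, _, ArnouxRauzy.isParameter_tribonacci, hT⟩, fun B hB => ?_⟩, hb, fun B hB hlt => ?_⟩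
  · obtain ⟨μ, hμ, hB⟩ := hp.hasUpperBL
    exact ⟨_, hB, hp.upperBLOf_eq_top_iff hμ⟩
  · rcases ArnouxRauzy.eq_or_le_of_mem_upperBLSpectrum hy l₁ l₂ hB with h | h
    · exact h.ge
    · exact (ENNReal.ofReal_le_ofReal hb.le).trans h
  · exact (ArnouxRauzy.eq_or_le_of_mem_upperBLSpectrum hy l₁ l₂ hB).resolve_right hlt.not_ge
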